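/- For $k_{\rm F}>0$ let $B_{\rm F}=\{p\in\mathbb Z^3:|p|\le k_{\rm F}\}$, $B_{\rm F}^c=\mathbb Z^3\setminus B_{\rm F}$, $N=|B_{\rm F}|$, $\hbar=N^{-1/3}$, $\kappa=k_{\rm F}N^{-1/3}$ and $e(p)=|\hbar^2|p|^2-\kappa^2|$ for $p\in\mathbb Z^3$. On the fermionic Fock space $\mathcal F=\bigoplus_{n\ge0}L^2(\mathbb T^3)^{\otimes_a n}$, $\mathbb T^3=\mathbb R^3/(2\pi\mathbb Z^3)$, let $a_p,a_p^*$ be the annihilation and creation operators of the plane waves $(2\pi)^{-3/2}e^{ip\cdot x}$, $p\in\mathbb Z^3$, and let $\mathbb H_0=\sum_{p\in\mathbb Z^3}e(p)\,a_p^*a_p$, a non-negative self-adjoint operator with square root $\mathbb H_0^{1/2}$. (i) There is a constant $C>0$ such that for all $k_{\rm F}>0$, all $k\in\mathbb Z^3$ and all $\psi$ in the domain of $\mathbb H_0^{1/2}$, $$\sum_{p\in B_{\rm F}^c\cap(B_{\rm F}+k)}\|a_pa_{p-k}\psi\|\le C\,N^{1/2}\,\|\mathbb H_0^{1/2}\psi\|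 .$$ (ii) For all $\delta\in(0,1/6)$ and $c>0$ there is a constant $C>0$ such that for all $k_{\rm F}>0$, all $k\in\mathbb Z^3$ and all $\psi$ in the domain of $\mathbb H_0^{1/2}$, $$\sum_{\substack{p\in B_{\rm F}^c\cap(B_{\rm F}+k):\\ e(p)+e(p-k)\le c\,N^{-1/3-\delta}}}\|a_pa_{p-k}\psi\|\le C\,N^{1/2-\delta/2}\,\|\mathbb H_0^{1/2}\psi\| .$$ -/

import Mathlib

noncomputable section

namespace FermiGas

/-! ### Momenta, Fermi ball, excitation energies -/

/-- Momenta `p ∈ ℤ³`. -/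
abbrev Mom : Type := Fin 3 → ℤ

/-- The squared Euclidean length `p² = p₁² + p₂² + p₃²`. -/
def normSq (p : Mom) : ℝ := ∑ i, (p i : ℝ) ^ 2

theorem finite_ball (kF : ℝ) : {p : Mom | Real.sqrt (normSq p) ≤ kF}.Finite := by
  refine (Set.Finite.pi (fun _ : Fin 3 => Set.finite_Icc (-⌈kF⌉) ⌈kF⌉)).subset ?_
  intro p hp i _
  have hp' : Real.sqrt (normSq p) ≤ kF := hp
  have h1 : |(p i : ℝ)| ≤ kF := by
    refine le_trans ?_ hp'
    rw [← Real.sqrt_sq_eq_abs]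
    apply Real.sqrt_le_sqrt
    exact Finset.single_le_sum (f := fun i => (p i : ℝ) ^ 2) (fun j _ => sq_nonneg _)
      (Finset.mem_univ i)
  obtain ⟨h2, h3⟩ := abs_le.1 h1
  have h4 := Int.le_ceil kF
  constructor
  · have : ((-⌈kF⌉ : ℤ) : ℝ) ≤ p i := by push_cast; linarith
    exact_mod_cast this
  · have : (p i : ℝ) ≤ (⌈kF⌉ : ℤ) := by linarith
    exact_mod_cast this

/-- The Fermi ball `B_F = {p ∈ ℤ³ : |p| ≤ k_F}`. -/
def fermiBall (kF : ℝ) : Finset Mom := (finite_ball kF).toFinset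

/-- The number of particles `N = |B_F|`, as a real number. -/
def numPart (kF : ℝ) : ℝ := ((fermiBall kF).card : ℝ)

/-- `ħ = N^{-1/3}`. -/
def hbar (kF : ℝ) : ℝ := numPart kF ^ (-(1 / 3) : ℝ)

/-- The number `κ` with `k_F = κ N^{1/3}`. -/
def kappa (kF : ℝ) : ℝ := kF / numPart kF ^ (1 / 3 : ℝ)

/-- The excitation energy `e(p) = |ħ² p² - κ²|`. -/
def energy (kF : ℝ) (p : Mom) : ℝ := |hbar kF ^ 2 * normSq p - kappa kF ^ 2|

/-- The finite set `B_F^c ∩ (B_F + k)`. -/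
def pairSet (kF : ℝ) (k : Mom) : Finset Mom :=
  ((fermiBall kF).image fun q => q + k) \ fermiBall kF

/-! ### Fermionic Fock space

The one-particle space `L²(𝕋³)` is written in the orthonormal basis of plane waves
`(2π)^{-3/2} exp(i p·x)`, that is, as `ℓ²(ℤ³)`; accordingly `L²(𝕋³)^{⊗ n}` is `ℓ²((ℤ³)ⁿ)`, and
the direct sum over all `n ≥ 0` is the `ℓ²` space over the disjoint union of all `(ℤ³)ⁿ`. -/

/-- Configurations `(n; p₁, …, pₙ)` of any number of momenta. -/
abbrev Conf : Type := Σ n : ℕ, (Fin n → Mom)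

/-- Fermionic Fock space `⨁ₙ L²(𝕋³)^{⊗ₐ n}` in momentum space: square summable amplitudes
`ψ⁽ⁿ⁾(p₁, …, pₙ)`, `n ≥ 0`, which are antisymmetric under permutations of the momenta. -/
def fockSpace : Submodule ℂ (lp (fun _ : Conf => ℂ) 2) where
  carrier := {ψ | ∀ (n : ℕ) (σ : Equiv.Perm (Fin n)) (P : Fin n → Mom),
    ψ ⟨n, P ∘ σ⟩ = ((Equiv.Perm.sign σ : ℤ) : ℂ) * ψ ⟨n, P⟩}
  add_mem' := by
    intro a b ha hb n σ P
    simp only [lp.coeFn_add, Pi.add_apply, ha n σ P, hb n σ P, mul_add]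
  zero_mem' := by intro n σ P; simp
  smul_mem' := by
    intro c a ha n σ P
    simp only [lp.coeFn_smul, Pi.smul_apply, ha n σ P, smul_eq_mul]
    ring

/-- Fermionic Fock space as a type. -/
abbrev Fock : Type := fockSpace

theorem isClosed_fockSpace : IsClosed (fockSpace : Set (lp (fun _ : Conf => ℂ) 2)) := by
  have hc : ∀ c : Conf, Continuous fun ψ : lp (fun _ : Conf => ℂ) 2 => ψ c :=
    fun c => (lp.lipschitzWith_one_eval (E := fun _ : Conf => ℂ) 2 c).continuous
  have : (fockSpace : Set (lp (fun _ : Conf => ℂ) 2)) =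
      ⋂ (n : ℕ), ⋂ (σ : Equiv.Perm (Fin n)), ⋂ (P : Fin n → Mom),
        {ψ | ψ ⟨n, P ∘ σ⟩ = ((Equiv.Perm.sign σ : ℤ) : ℂ) * ψ ⟨n, P⟩} := by
    ext ψ
    simp only [Set.mem_iInter]
    rfl
  rw [this]
  refine isClosed_iInter fun n => isClosed_iInter fun σ => isClosed_iInter fun P => ?_
  exact isClosed_eq (hc _) (continuous_const.mul (hc _))

instance : CompleteSpace Fock := isClosed_fockSpace.completeSpace_coe

/-- The amplitude of a Fock space vector at a configuration. -/
def amp (ψ : Fock) (c : Conf) : ℂ := (ψ : lp (fun _ : Conf => ℂ) 2) c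

theorem Fock.ext {ψ φ : Fock} (h : ∀ c, amp ψ c = amp φ c) : ψ = φ :=
  Subtype.ext (lp.ext (funext h))

theorem amp_perm (ψ : Fock) (n : ℕ) (σ : Equiv.Perm (Fin n)) (P : Fin n → Mom) :
    amp ψ ⟨n, P ∘ σ⟩ = ((Equiv.Perm.sign σ : ℤ) : ℂ) * amp ψ ⟨n, P⟩ := ψ.2 n σ P

theorem enorm_amp_perm (ψ : Fock) (n : ℕ) (σ : Equiv.Perm (Fin n)) (P : Fin n → Mom) :
    ‖amp ψ ⟨n, P ∘ σ⟩‖ₑ = ‖amp ψ ⟨n, P⟩‖ₑ := by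
  rw [amp_perm, enorm_mul]
  rcases Int.units_eq_one_or (Equiv.Perm.sign σ) with h | h <;> simp [h]

/-- The Pauli principle: amplitudes vanish where two momenta coincide. -/
theorem amp_eq_zero (ψ : Fock) {n : ℕ} {P : Fin n → Mom} {i j : Fin n} (hij : i ≠ j)
    (h : P i = P j) : amp ψ ⟨n, P⟩ = 0 := by
  have h1 := amp_perm ψ n (Equiv.swap i j) P
  have h2 : P ∘ Equiv.swap i j = P := by
    funext l
    simp only [Function.comp_apply]
    rcases eq_or_ne l i with rfl | hi
    · simp [h]
    · rcases eq_or_ne l j with rfl | hj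
      · simp [h]
      · rw [Equiv.swap_apply_of_ne_of_ne hi hj]
  rw [h2, Equiv.Perm.sign_swap hij] at h1
  push_cast at h1
  have h3 : (2 : ℂ) * amp ψ ⟨n, P⟩ = 0 := by linear_combination h1
  simpa using h3

theorem tsum_enorm_amp (ψ : Fock) : ∑' c, ‖amp ψ c‖ₑ ^ 2 = ‖ψ‖ₑ ^ 2 := by
  have h := lp.hasSum_norm (p := 2) (by norm_num) (ψ : lp (fun _ : Conf => ℂ) 2)
  simp only [ENNReal.toReal_ofNat, Real.rpow_ofNat] at h
  have h' : HasSum (fun c => ‖amp ψ c‖ ^ 2) (‖ψ‖ ^ 2) := h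
  have h2 := ENNReal.ofReal_tsum_of_nonneg (fun c => sq_nonneg ‖amp ψ c‖) h'.summable
  rw [h'.tsum_eq] at h2
  rw [ENNReal.ofReal_pow (norm_nonneg _), ofReal_norm] at h2
  rw [h2]
  refine tsum_congr fun c => ?_
  rw [ENNReal.ofReal_pow (norm_nonneg _), ofReal_norm]

/-- The vector with given square summable antisymmetric amplitudes. -/
def mkFock (f : Conf → ℂ) (hf : ∑' c, ‖f c‖ₑ ^ 2 ≠ ⊤)
    (hs : ∀ (n : ℕ) (σ : Equiv.Perm (Fin n)) (P : Fin n → Mom),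
      f ⟨n, P ∘ σ⟩ = ((Equiv.Perm.sign σ : ℤ) : ℂ) * f ⟨n, P⟩) : Fock :=
  ⟨⟨f, memℓp_gen (by
    have := ENNReal.summable_toReal hf
    simpa using this)⟩, hs⟩

@[simp] theorem amp_mkFock (f : Conf → ℂ) (hf) (hs) (c : Conf) : amp (mkFock f hf hs) c = f c :=
  rfl

/-! ### Annihilation operators -/

/-- The number of times that the momentum `p` occurs in a configuration. -/
def occ (p : Mom) (c : Conf) : ℕ := (Finset.univ.filter fun j => c.2 j = p).card

theorem tsum_cons (f : Conf → ENNReal)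
    (hf : ∀ (n : ℕ) (σ : Equiv.Perm (Fin n)) (P : Fin n → Mom), f ⟨n, P ∘ σ⟩ = f ⟨n, P⟩)
    (p : Mom) :
    ∑' c : Conf, ((c.1 + 1 : ℕ) : ENNReal) * f ⟨c.1 + 1, Fin.cons p c.2⟩ =
      ∑' c : Conf, (occ p c : ENNReal) * f c := by
  rw [ENNReal.tsum_sigma', ENNReal.tsum_sigma']
  conv_rhs => rw [tsum_eq_zero_add' ENNReal.summable]
  have h0 : ∑' P : Fin 0 → Mom, (occ p ⟨0, P⟩ : ENNReal) * f ⟨0, P⟩ = 0 := by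
    simp [occ]
  rw [h0, zero_add]
  refine tsum_congr fun n => ?_
  have h1 : ∀ P : Fin (n + 1) → Mom, (occ p ⟨n + 1, P⟩ : ENNReal) * f ⟨n + 1, P⟩ =
      ∑ j : Fin (n + 1), if P j = p then f ⟨n + 1, P⟩ else 0 := by
    intro P
    rw [← Finset.sum_filter, Finset.sum_const, nsmul_eq_mul]
    rfl
  simp_rw [h1]
  rw [Summable.tsum_finsetSum (fun _ _ => ENNReal.summable)]
  have h2 : ∀ j : Fin (n + 1), ∑' P : Fin (n + 1) → Mom,
      (if P j = p then f ⟨n + 1, P⟩ else 0) = ∑' P : Fin n → Mom, f ⟨n + 1, Fin.cons p P⟩ := by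
    intro j
    rw [← (Fin.insertNthEquiv (fun _ => Mom) j).tsum_eq, ENNReal.tsum_prod', tsum_eq_single p]
    · refine tsum_congr fun P => ?_
      have h3 : (Fin.insertNthEquiv (fun _ => Mom) j) (p, P) =
          (Fin.cons p P : Fin (n + 1) → Mom) ∘ j.cycleRange := by
        rw [Fin.cons_comp_cycleRange]
        rfl
      have h4 : (Fin.insertNthEquiv (fun _ => Mom) j) (p, P) j = p := by
        simp [Fin.insertNthEquiv]
      rw [if_pos h4, h3, hf]
    · intro q hq
      simp [Fin.insertNthEquiv, hq]
  simp_rw [h2]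
  rw [Finset.sum_const, Finset.card_univ, Fintype.card_fin, nsmul_eq_mul, ENNReal.tsum_mul_left]

theorem occ_le_one (ψ : Fock) (p : Mom) (c : Conf) (h : amp ψ c ≠ 0) : occ p c ≤ 1 := by
  refine Finset.card_le_one.2 fun i hi j hj => ?_
  by_contra hij
  simp only [Finset.mem_filter] at hi hj
  exact h (amp_eq_zero (P := c.2) ψ hij (hi.2.trans hj.2.symm))

/-- The amplitudes `√(n+1) ψ⁽ⁿ⁺¹⁾(p, p₁, …, pₙ)` of `a_p ψ`. -/
def annihFun (p : Mom) (ψ : Fock) (c : Conf) : ℂ :=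
  (Real.sqrt ((c.1 + 1 : ℕ) : ℝ) : ℂ) * amp ψ ⟨c.1 + 1, Fin.cons p c.2⟩

theorem tsum_annihFun (p : Mom) (ψ : Fock) :
    ∑' c, ‖annihFun p ψ c‖ₑ ^ 2 = ∑' c, (occ p c : ENNReal) * ‖amp ψ c‖ₑ ^ 2 := by
  rw [← tsum_cons (fun c => ‖amp ψ c‖ₑ ^ 2)
    (fun n σ P => by simp only [enorm_amp_perm]) p]
  refine tsum_congr fun c => ?_
  rw [annihFun, enorm_mul, mul_pow]
  congr 1
  rw [← ofReal_norm, ← ENNReal.ofReal_pow (norm_nonneg _), Complex.norm_real,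
    Real.norm_of_nonneg (Real.sqrt_nonneg _), Real.sq_sqrt (Nat.cast_nonneg _),
    ENNReal.ofReal_natCast]

theorem tsum_occ_le (p : Mom) (ψ : Fock) :
    ∑' c, (occ p c : ENNReal) * ‖amp ψ c‖ₑ ^ 2 ≤ ‖ψ‖ₑ ^ 2 := by
  rw [← tsum_enorm_amp]
  refine ENNReal.tsum_le_tsum fun c => ?_
  by_cases h : amp ψ c = 0
  · simp [h]
  · have : (occ p c : ENNReal) ≤ 1 := by exact_mod_cast occ_le_one ψ p c h
    exact mul_le_of_le_one_left (zero_le) this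

theorem annihFun_perm (p : Mom) (ψ : Fock) (n : ℕ) (σ : Equiv.Perm (Fin n)) (P : Fin n → Mom) :
    annihFun p ψ ⟨n, P ∘ σ⟩ = ((Equiv.Perm.sign σ : ℤ) : ℂ) * annihFun p ψ ⟨n, P⟩ := by
  have h : (Fin.cons p (P ∘ σ) : Fin (n + 1) → Mom) =
      (Fin.cons p P : Fin (n + 1) → Mom) ∘ Equiv.Perm.decomposeFin.symm (0, σ) := by
    funext i
    refine Fin.cases ?_ (fun i => ?_) i
    · simp
    · simp
  simp only [annihFun, h, amp_perm]
  simp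
  ring

theorem tsum_annihFun_ne_top (p : Mom) (ψ : Fock) : ∑' c, ‖annihFun p ψ c‖ₑ ^ 2 ≠ ⊤ := by
  rw [tsum_annihFun]
  exact ne_top_of_le_ne_top (by simp) (tsum_occ_le p ψ)

theorem norm_annih_le (p : Mom) (ψ : Fock) :
    ‖mkFock (annihFun p ψ) (tsum_annihFun_ne_top p ψ) (annihFun_perm p ψ)‖ ≤ ‖ψ‖ := by
  have h := tsum_enorm_amp
    (mkFock (annihFun p ψ) (tsum_annihFun_ne_top p ψ) (annihFun_perm p ψ))
  simp only [amp_mkFock] at h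
  have h2 := (h.symm.trans (tsum_annihFun p ψ)).trans_le (tsum_occ_le p ψ)
  rw [ENNReal.pow_le_pow_left_iff (by norm_num)] at h2
  exact enorm_le_iff_norm_le.1 h2

/-- The annihilation operator `a_p`, given by
`(a_p ψ)⁽ⁿ⁾(p₁, …, pₙ) = √(n+1) ψ⁽ⁿ⁺¹⁾(p, p₁, …, pₙ)`. -/
def annih (p : Mom) : Fock →L[ℂ] Fock :=
  LinearMap.mkContinuous
    { toFun := fun ψ => mkFock (annihFun p ψ) (tsum_annihFun_ne_top p ψ) (annihFun_perm p ψ)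
      map_add' := fun _ _ => Fock.ext fun _ => mul_add _ _ _
      map_smul' := fun _ _ => Fock.ext fun _ => mul_left_comm _ _ _ } 1
    (fun ψ => (norm_annih_le p ψ).trans_eq (one_mul _).symm)

/-- The creation operator `a_p^*`. -/
def creat (p : Mom) : Fock →L[ℂ] Fock := ContinuousLinearMap.adjoint (annih p)

theorem amp_annih (p : Mom) (ψ : Fock) (n : ℕ) (P : Fin n → Mom) :
    amp (annih p ψ) ⟨n, P⟩ =
      (Real.sqrt ((n + 1 : ℕ) : ℝ) : ℂ) * amp ψ ⟨n + 1, Fin.cons p P⟩ := rfl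

theorem tsum_occ_mul_ne_top (p : Mom) (ψ : Fock) :
    ∑' c, ‖(occ p c : ℂ) * amp ψ c‖ₑ ^ 2 ≠ ⊤ := by
  refine ne_top_of_le_ne_top (b := ‖ψ‖ₑ ^ 2) (by simp) ?_
  rw [← tsum_enorm_amp]
  refine ENNReal.tsum_le_tsum fun c => ?_
  by_cases h : amp ψ c = 0
  · simp [h]
  · have h1 := occ_le_one ψ p c h
    interval_cases occ p c <;> simp

theorem occ_perm (p : Mom) (n : ℕ) (σ : Equiv.Perm (Fin n)) (P : Fin n → Mom) :
    occ p ⟨n, P ∘ σ⟩ = occ p ⟨n, P⟩ :=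
  Finset.card_equiv σ (by simp)

/-- `a_p^* a_p` multiplies the amplitudes by the occupation number of `p`. -/
theorem amp_creat_annih (p : Mom) (ψ : Fock) (c : Conf) :
    amp (creat p (annih p ψ)) c = (occ p c : ℂ) * amp ψ c := by
  let T : Fock →ₗ[ℂ] Fock :=
    { toFun := fun ψ => mkFock (fun c => (occ p c : ℂ) * amp ψ c) (tsum_occ_mul_ne_top p ψ)
        (fun n σ P => by simp only [occ_perm, amp_perm]; ring)
      map_add' := fun _ _ => Fock.ext fun _ => mul_add _ _ _
      map_smul' := fun _ _ => Fock.ext fun _ => mul_left_comm _ _ _ }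
  have hT : ∀ ψ c, amp (T ψ) c = (occ p c : ℂ) * amp ψ c := fun _ _ => rfl
  have key : ((creat p ∘L annih p : Fock →L[ℂ] Fock) : Fock →ₗ[ℂ] Fock) = T := by
    rw [← ext_inner_map]
    intro ψ
    have h1 : inner ℂ (creat p (annih p ψ)) ψ = ((‖annih p ψ‖ ^ 2 : ℝ) : ℂ) := by
      rw [creat, ContinuousLinearMap.adjoint_inner_left, inner_self_eq_norm_sq_to_K]
      simp
    have h2 : ‖annih p ψ‖ₑ ^ 2 = ∑' c, (occ p c : ENNReal) * ‖amp ψ c‖ₑ ^ 2 := by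
      rw [← tsum_enorm_amp, ← tsum_annihFun]
      rfl
    have h3 : HasSum (fun c => (occ p c : ℝ) * ‖amp ψ c‖ ^ 2) (‖annih p ψ‖ ^ 2) := by
      have hne : ∑' c, (occ p c : ENNReal) * ‖amp ψ c‖ₑ ^ 2 ≠ ⊤ := by
        rw [← h2]; simp
      have h4 := ENNReal.hasSum_toReal hne
      rw [← ENNReal.tsum_toReal_eq (fun c => ne_top_of_le_ne_top hne (ENNReal.le_tsum c)),
        ← h2] at h4
      simpa using h4
    have h5 : inner ℂ (T ψ) ψ = ((‖annih p ψ‖ ^ 2 : ℝ) : ℂ) := by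
      have h6 := lp.hasSum_inner (𝕜 := ℂ) (G := fun _ : Conf => ℂ) (T ψ).1 ψ.1
      have h7 := Complex.hasSum_ofReal.2 h3
      refine HasSum.unique h6 ?_
      convert! h7 using 2 with c
      change inner ℂ ((occ p c : ℂ) * amp ψ c) (amp ψ c) = _
      rw [← smul_eq_mul, inner_smul_left, inner_self_eq_norm_sq_to_K]
      simp
    exact h1.trans h5.symm
  have := LinearMap.congr_fun key ψ
  rw [← hT, ← this]
  rfl

/-! ### Kinetic energy -/

/-- The (densely defined, unbounded) kinetic energy operator `ℍ₀ = ∑ₚ e(p) a_p^* a_p`, on the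
domain of all vectors for which the sum converges. -/
def kinetic (kF : ℝ) : Fock →ₗ.[ℂ] Fock :=
  Submodule.toLinearPMap
    { carrier := {x | HasSum (fun p => (energy kF p : ℂ) • creat p (annih p x.1)) x.2}
      add_mem' := by
        intro x y hx hy
        have h := HasSum.add hx hy
        simp only [← smul_add, ← map_add] at h
        exact h
      zero_mem' := by
        simp only [Set.mem_ofPred_eq, Prod.fst_zero, Prod.snd_zero, map_zero, smul_zero]
        exact hasSum_zero
      smul_mem' := by
        intro z x hx
        have h := HasSum.const_smul z hx
        have h2 : ∀ p, z • (energy kF p : ℂ) • creat p (annih p x.1) =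
            (energy kF p : ℂ) • creat p (annih p (z • x.1)) := fun p => by
          rw [smul_comm, map_smul, map_smul]
        simp only [h2] at h
        exact h }

/-- The total excitation energy `∑ⱼ e(pⱼ)` of a configuration. -/
def totalEnergy (kF : ℝ) (c : Conf) : ℝ := ∑ j, energy kF (c.2 j)

/-- The operator `ℍ₀^{1/2}`: the (maximal) operator of multiplication of the amplitudes by
`(∑ⱼ e(pⱼ))^{1/2}`. -/
def kineticSqrt (kF : ℝ) : Fock →ₗ.[ℂ] Fock :=
  Submodule.toLinearPMap
    { carrier := {x | ∀ c, amp x.2 c = (Real.sqrt (totalEnergy kF c) : ℂ) * amp x.1 c}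
      add_mem' := by
        intro x y hx hy c
        have h1 : amp (x + y).2 c = amp x.2 c + amp y.2 c := rfl
        have h2 : amp (x + y).1 c = amp x.1 c + amp y.1 c := rfl
        rw [h1, h2, hx c, hy c, mul_add]
      zero_mem' := fun c => (mul_zero _).symm
      smul_mem' := by
        intro z x hx c
        have h1 : amp (z • x).2 c = z * amp x.2 c := rfl
        have h2 : amp (z • x).1 c = z * amp x.1 c := rfl
        rw [h1, h2, hx c, mul_left_comm] }

theorem mem_kineticSqrt_graph (kF : ℝ) (ψ φ : Fock) : (ψ, φ) ∈ (kineticSqrt kF).graph ↔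
    ∀ c, amp φ c = (Real.sqrt (totalEnergy kF c) : ℂ) * amp ψ c := by
  rw [kineticSqrt, Submodule.toLinearPMap_graph_eq]
  · rfl
  · intro x hx h0
    refine Fock.ext fun c => ?_
    have := hx c
    rw [h0] at this
    exact this.trans (mul_zero _)

theorem mem_kinetic_graph (kF : ℝ) (ψ φ : Fock) : (ψ, φ) ∈ (kinetic kF).graph ↔
    HasSum (fun p => (energy kF p : ℂ) • creat p (annih p ψ)) φ := by
  rw [kinetic, Submodule.toLinearPMap_graph_eq]
  · rfl
  · intro x hx h0
    have h1 : HasSum (fun p => (energy kF p : ℂ) • creat p (annih p x.1)) x.2 := hx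
    simp only [h0, map_zero, smul_zero] at h1
    exact h1.unique hasSum_zero

theorem energy_nonneg (kF : ℝ) (p : Mom) : 0 ≤ energy kF p := abs_nonneg _

theorem totalEnergy_nonneg (kF : ℝ) (c : Conf) : 0 ≤ totalEnergy kF c :=
  Finset.sum_nonneg fun _ _ => energy_nonneg _ _

theorem hasSum_occ (kF : ℝ) (c : Conf) :
    HasSum (fun p => energy kF p * (occ p c : ℝ)) (totalEnergy kF c) := by
  have h : ∀ j : Fin c.1, HasSum (fun p => if p = c.2 j then energy kF (c.2 j) else 0)
      (energy kF (c.2 j)) := fun j => hasSum_ite_eq _ _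
  have h2 := hasSum_sum (s := Finset.univ) (fun j _ => h j)
  convert! h2 using 2 with p
  rw [occ, Finset.card_filter]
  push_cast
  rw [Finset.mul_sum]
  refine Finset.sum_congr rfl fun j _ => ?_
  by_cases hj : c.2 j = p
  · simp [hj]
  · simp [hj, Ne.symm hj]

theorem totalEnergy_perm (kF : ℝ) (n : ℕ) (σ : Equiv.Perm (Fin n)) (P : Fin n → Mom) :
    totalEnergy kF ⟨n, P ∘ σ⟩ = totalEnergy kF ⟨n, P⟩ :=
  Equiv.sum_comp σ fun j => energy kF (P j)

theorem continuous_amp (c : Conf) : Continuous fun ψ : Fock => amp ψ c :=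
  (lp.lipschitzWith_one_eval (E := fun _ : Conf => ℂ) 2 c).continuous.comp continuous_subtype_val

/-- The amplitude at a configuration, as an additive map. -/
def ampHom (c : Conf) : Fock →+ ℂ where
  toFun ψ := amp ψ c
  map_zero' := rfl
  map_add' _ _ := rfl

theorem hasSum_amp_sq (ψ : Fock) : HasSum (fun c => ‖amp ψ c‖ ^ 2) (‖ψ‖ ^ 2) := by
  have h := lp.hasSum_norm (p := 2) (by norm_num) (ψ : lp (fun _ : Conf => ℂ) 2)
  simp only [ENNReal.toReal_ofNat, Real.rpow_ofNat] at h
  exact h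

theorem mem_kinetic_graph_iff_amp (kF : ℝ) (ψ φ : Fock) : (ψ, φ) ∈ (kinetic kF).graph ↔
    ∀ c, amp φ c = (totalEnergy kF c : ℂ) * amp ψ c := by
  have hterm : ∀ p c, amp ((energy kF p : ℂ) • creat p (annih p ψ)) c =
      ((energy kF p * (occ p c : ℝ) : ℝ) : ℂ) * amp ψ c := by
    intro p c
    have : amp ((energy kF p : ℂ) • creat p (annih p ψ)) c =
      (energy kF p : ℂ) * amp (creat p (annih p ψ)) c := rfl
    rw [this, amp_creat_annih]
    push_cast
    ring
  have hc : ∀ c, HasSum (fun p => amp ((energy kF p : ℂ) • creat p (annih p ψ)) c)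
      ((totalEnergy kF c : ℂ) * amp ψ c) := by
    intro c
    simp only [hterm]
    exact (Complex.hasSum_ofReal.2 (hasSum_occ kF c)).mul_right _
  rw [mem_kinetic_graph]
  constructor
  · intro h c
    exact (h.map (ampHom c) (continuous_amp c)).unique (hc c)
  · intro h
    rw [HasSum, SummationFilter.unconditional_filter, tendsto_iff_norm_sub_tendsto_zero]
    have hsum : ∀ (S : Finset Mom) (c : Conf),
        amp (∑ p ∈ S, (energy kF p : ℂ) • creat p (annih p ψ)) c =
          ((∑ p ∈ S, energy kF p * (occ p c : ℝ) : ℝ) : ℂ) * amp ψ c := by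
      intro S c
      have := map_sum (ampHom c) (fun p => (energy kF p : ℂ) • creat p (annih p ψ)) S
      refine this.trans ?_
      rw [Complex.ofReal_sum, Finset.sum_mul]
      exact Finset.sum_congr rfl fun p _ => hterm p c
    have hdom : Filter.Tendsto (fun S : Finset Mom => ∑' c,
        ‖amp (∑ p ∈ S, (energy kF p : ℂ) • creat p (annih p ψ) - φ) c‖ ^ 2) Filter.atTop
        (nhds (∑' _ : Conf, (0 : ℝ))) := by
      refine tendsto_tsum_of_dominated_convergence (hasSum_amp_sq φ).summable ?_ ?_
      · intro c
        have h1 := (hc c)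
        rw [← h c, HasSum, SummationFilter.unconditional_filter,
          tendsto_iff_norm_sub_tendsto_zero] at h1
        have h2 := h1.pow 2
        rw [zero_pow two_ne_zero] at h2
        refine h2.congr fun S => ?_
        have := map_sum (ampHom c) (fun p => (energy kF p : ℂ) • creat p (annih p ψ)) S
        have h3 := map_sub (ampHom c) (∑ p ∈ S, (energy kF p : ℂ) • creat p (annih p ψ)) φ
        rw [this] at h3
        exact congrArg (fun z : ℂ => ‖z‖ ^ 2) h3.symm
      · refine Filter.Eventually.of_forall fun S c => ?_
        have h3 := map_sub (ampHom c) (∑ p ∈ S, (energy kF p : ℂ) • creat p (annih p ψ)) φ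
        have h4 : amp (∑ p ∈ S, (energy kF p : ℂ) • creat p (annih p ψ) - φ) c =
            ((∑ p ∈ S, energy kF p * (occ p c : ℝ) - totalEnergy kF c : ℝ) : ℂ) *
              amp ψ c := by
          refine h3.trans ?_
          refine (congrArg₂ (· - ·) (hsum S c) (h c)).trans ?_
          push_cast
          ring
        rw [h4, h c, Real.norm_of_nonneg (by positivity), norm_mul, norm_mul,
          Complex.norm_real, Complex.norm_real]
        have h5 : ∑ p ∈ S, energy kF p * (occ p c : ℝ) ≤ totalEnergy kF c :=
          sum_le_hasSum S (fun p _ => mul_nonneg (energy_nonneg _ _) (Nat.cast_nonneg _))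
            (hasSum_occ kF c)
        have h6 : 0 ≤ ∑ p ∈ S, energy kF p * (occ p c : ℝ) :=
          Finset.sum_nonneg fun p _ => mul_nonneg (energy_nonneg _ _) (Nat.cast_nonneg _)
        gcongr ?_ ^ 2
        refine mul_le_mul_of_nonneg_right ?_ (norm_nonneg _)
        rw [Real.norm_eq_abs, Real.norm_eq_abs, abs_of_nonneg (totalEnergy_nonneg _ _), abs_le]
        constructor <;> linarith
    rw [tsum_zero] at hdom
    have h7 : Filter.Tendsto (fun S : Finset Mom =>
        ‖∑ p ∈ S, (energy kF p : ℂ) • creat p (annih p ψ) - φ‖ ^ 2) Filter.atTop (nhds 0) := by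
      refine hdom.congr fun S => ?_
      exact (hasSum_amp_sq _).tsum_eq
    have h8 := h7.sqrt
    simpa using h8

/-- `ℍ₀^{1/2} ℍ₀^{1/2} = ℍ₀`, including the domains. -/
theorem kineticSqrt_sq (kF : ℝ) (ψ φ : Fock) : (ψ, φ) ∈ (kinetic kF).graph ↔
    ∃ χ, (ψ, χ) ∈ (kineticSqrt kF).graph ∧ (χ, φ) ∈ (kineticSqrt kF).graph := by
  have hss : ∀ c, (Real.sqrt (totalEnergy kF c) : ℂ) * (Real.sqrt (totalEnergy kF c) : ℂ) =
      (totalEnergy kF c : ℂ) := by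
    intro c
    rw [← Complex.ofReal_mul, Real.mul_self_sqrt (totalEnergy_nonneg _ _)]
  simp only [mem_kinetic_graph_iff_amp, mem_kineticSqrt_graph]
  constructor
  · intro h
    have hsm : Summable fun c => ‖(Real.sqrt (totalEnergy kF c) : ℂ) * amp ψ c‖ ^ 2 := by
      refine Summable.of_nonneg_of_le (fun c => sq_nonneg _) (fun c => ?_)
        ((hasSum_amp_sq ψ).summable.add (hasSum_amp_sq φ).summable)
      have hE := totalEnergy_nonneg kF c
      rw [h c, norm_mul, norm_mul, Complex.norm_real, Complex.norm_real, mul_pow, mul_pow,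
        Real.norm_of_nonneg hE, Real.norm_of_nonneg (Real.sqrt_nonneg _), Real.sq_sqrt hE]
      nlinarith [sq_nonneg ‖amp ψ c‖, mul_nonneg (sq_nonneg ‖amp ψ c‖)
        (sq_nonneg (totalEnergy kF c - 1)), mul_nonneg (sq_nonneg ‖amp ψ c‖) hE]
    refine ⟨mkFock (fun c => (Real.sqrt (totalEnergy kF c) : ℂ) * amp ψ c) ?_ ?_, fun c => rfl,
      fun c => ?_⟩
    · have := hsm.tsum_ofReal_ne_top
      simpa only [ENNReal.ofReal_pow (norm_nonneg _), ofReal_norm] using this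
    · intro n σ P
      rw [totalEnergy_perm, amp_perm]
      ring
    · rw [amp_mkFock, ← mul_assoc, hss, h c]
  · rintro ⟨χ, h1, h2⟩ c
    rw [h2 c, h1 c, ← mul_assoc, hss]

end FermiGas

end

open FermiGas

/-!
By the Cauchy–Schwarz inequality with weights `e(p) + e(p - k)` and the canonical anticommutation
relations, both estimates reduce to lattice sums (`sum_norm_annih_annih_le`). With the integer gap
`λ(p) = p² - (p - k)² = 2 k·p - k² ≥ 1` one has `e(p) + e(p - k) = N^{-2/3} λ(p)`, so what is needed
is `∑ 1/λ(p) ≪ N^{1/3}` over all pairs, and `≪ M` over those with `λ(p) ≤ M = c N^{1/3 - δ}`,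
uniformly in `k`. Write `R` for the Fermi momentum, which is of order `N^{1/3}` as soon as `R ≥
1`; for `R < 1` one has `N = 1`, and there is at most one pair. Since `δ < 1/6`, the threshold `M`
is at least of order `R^{1/2 + ε}` for some `ε > 0`, and both bounds follow from `∑_{λ ≤ M} 1/λ ≪
R^{1/2 + ε} + M / |k|` (`exists_sum_gap_le`), valid for `|k| ≤ 3R`, where all gaps are at most `5
R |k|`; the case `|k| > 3R` is trivial, all gaps being at least `3R²`. The proof treats gaps up to
`√R` and larger gaps separately.

*Gaps up to `√R`.* Fixing `λ = m` puts `p` in a plane orthogonal to `k` and leaves `m` values for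
`p²`, hence `m` circles. A circle carries `≪ R^ε` integer points uniformly in `k`
(`exists_card_circle_le`): in coordinates along an orthogonal frame it becomes `X² + E Y² = W`, which
has at most `10 d(W)²` solutions for every `E > 0` (`card_form_le`), and `d(W) ≪ W^ε`. So the sum is
`≪ R^{1/2 + ε}`.

*Larger gaps.* The number of pairs with `λ ≤ M` is `≪ √R M + M² / |k|` for all `M ≥ √R`
(`exists_card_gap_le`); summation over dyadic `M` costs a logarithm in the first term only. To prove
this, project along `k`: the pairs fall into a planar annulus. If the annulus is wide, then its area
and perimeter suffice (`Frame.exists_card_annulus_le`). If it is thin, of radius `ρ` and area `L²`, it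
is cut into `ρ / L` cells of diameter of order `L`, and the square of the number of points is at most
`ρ / L` times the number of pairs of points in a common cell (`Frame.exists_card_thin_annulus_le`).
Such pairs are counted by their difference `v`: both ends lie in the annulus, which forces
`|q·v| ≪ L²`, so that `q` is confined to a piece of the annulus of length `L² / |v|`
(`Frame.exists_card_chord_le`, `Frame.exists_card_pairs_le`). The density of the projected points is
the axial range `M / |k|` of the pairs, or one period `|k|` if that is shorter: a line in the
direction `k` leaves the ball only once, so translation into one period loses nothing.
-/

noncomputable section

namespace FermiGas

/-! ### Annihilation operators against the kinetic energy -/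

/-- Annihilation operators anticommute. -/
theorem annih_annih (p q : Mom) (ψ : Fock) : annih p (annih q ψ) = -annih q (annih p ψ) := by
  refine Fock.ext fun c => ?_
  obtain ⟨n, P⟩ := c
  have hneg : amp (-annih q (annih p ψ)) ⟨n, P⟩ = -amp (annih q (annih p ψ)) ⟨n, P⟩ := rfl
  have hcons : (Fin.cons q (Fin.cons p P : Fin (n + 1) → Mom) : Fin (n + 2) → Mom) =
      (Fin.cons p (Fin.cons q P : Fin (n + 1) → Mom) : Fin (n + 2) → Mom) ∘ Equiv.swap 0 1 := by
    funext i
    refine Fin.cases ?_ (fun i => Fin.cases ?_ (fun i => ?_) i) i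
    · simp only [Function.comp_apply, Equiv.swap_apply_left]; rfl
    · simp only [Function.comp_apply, Fin.succ_zero_eq_one, Equiv.swap_apply_right]; rfl
    · have h0 : (i.succ.succ : Fin (n + 2)) ≠ 0 := Fin.succ_ne_zero _
      have h1 : (i.succ.succ : Fin (n + 2)) ≠ 1 := by
        rw [← Fin.succ_zero_eq_one]
        exact fun h => Fin.succ_ne_zero _ (Fin.succ_injective _ h)
      simp only [Function.comp_apply, Equiv.swap_apply_of_ne_of_ne h0 h1, Fin.cons_succ]
  rw [hneg]
  simp only [amp_annih]
  rw [hcons, amp_perm, Equiv.Perm.sign_swap (by simp)]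
  push_cast
  ring

theorem hasSum_annih_sq (p : Mom) (ψ : Fock) :
    HasSum (fun c => (occ p c : ℝ) * ‖amp ψ c‖ ^ 2) (‖annih p ψ‖ ^ 2) := by
  have h2 : ‖annih p ψ‖ₑ ^ 2 = ∑' c, (occ p c : ENNReal) * ‖amp ψ c‖ₑ ^ 2 := by
    rw [← tsum_enorm_amp, ← tsum_annihFun]
    rfl
  have hne : ∑' c, (occ p c : ENNReal) * ‖amp ψ c‖ₑ ^ 2 ≠ ⊤ := by
    rw [← h2]; simp
  have h4 := ENNReal.hasSum_toReal hne
  rw [← ENNReal.tsum_toReal_eq (fun c => ne_top_of_le_ne_top hne (ENNReal.le_tsum c)), ← h2] at h4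
  simpa using h4

theorem norm_annih_apply_le (p : Mom) (ψ : Fock) : ‖annih p ψ‖ ≤ ‖ψ‖ := norm_annih_le p ψ

/-- The quadratic form of any finite part of `ℍ₀` is bounded by that of `ℍ₀`. -/
theorem sum_energy_annih_sq_le (kF : ℝ) (T : Finset Mom) (ψ : (kineticSqrt kF).domain) :
    ∑ p ∈ T, energy kF p * ‖annih p (ψ : Fock)‖ ^ 2 ≤ ‖kineticSqrt kF ψ‖ ^ 2 := by
  have hg : ((ψ : Fock), kineticSqrt kF ψ) ∈ (kineticSqrt kF).graph :=
    (kineticSqrt kF).mem_graph ψ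
  rw [mem_kineticSqrt_graph] at hg
  have h1 : HasSum (fun c => ∑ p ∈ T, energy kF p * ((occ p c : ℝ) * ‖amp (ψ : Fock) c‖ ^ 2))
      (∑ p ∈ T, energy kF p * ‖annih p (ψ : Fock)‖ ^ 2) :=
    hasSum_sum fun p _ => (hasSum_annih_sq p ψ).mul_left _
  refine hasSum_le (fun c => ?_) h1 (hasSum_amp_sq (kineticSqrt kF ψ))
  rw [hg c, norm_mul, mul_pow, Complex.norm_real, Real.norm_of_nonneg (Real.sqrt_nonneg _),
    Real.sq_sqrt (totalEnergy_nonneg _ _)]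
  simp_rw [← mul_assoc]
  rw [← Finset.sum_mul]
  refine mul_le_mul_of_nonneg_right ?_ (sq_nonneg _)
  exact sum_le_hasSum T (fun p _ => mul_nonneg (energy_nonneg _ _) (Nat.cast_nonneg _))
    (hasSum_occ kF c)

theorem sum_pair_energy_le (kF : ℝ) (k : Mom) (T : Finset Mom) (ψ : (kineticSqrt kF).domain) :
    ∑ p ∈ T, (energy kF p + energy kF (p - k)) * ‖annih p (annih (p - k) (ψ : Fock))‖ ^ 2 ≤
      2 * ‖kineticSqrt kF ψ‖ ^ 2 := by
  have h1 := sum_energy_annih_sq_le kF T ψ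
  have h2 := sum_energy_annih_sq_le kF (T.image fun p => p - k) ψ
  rw [Finset.sum_image (fun a _ b _ h => sub_left_injective h)] at h2
  rw [two_mul]
  refine le_trans ?_ (add_le_add h1 h2)
  rw [← Finset.sum_add_distrib]
  refine Finset.sum_le_sum fun p _ => ?_
  rw [add_mul]
  have hp := energy_nonneg kF p
  have hq := energy_nonneg kF (p - k)
  gcongr
  · rw [annih_annih, norm_neg]
    exact norm_annih_apply_le _ _
  · exact norm_annih_apply_le _ _

/-- Cauchy–Schwarz with the weights `e(p) + e(p - k)` reduces the estimate of the pair operators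
to a lattice sum. -/
theorem sum_norm_annih_annih_le (kF : ℝ) (k : Mom) (T : Finset Mom)
    (hT : ∀ p ∈ T, 0 < energy kF p + energy kF (p - k)) (ψ : (kineticSqrt kF).domain) {S : ℝ}
    (hS : ∑ p ∈ T, (energy kF p + energy kF (p - k))⁻¹ ≤ S) :
    ∑ p ∈ T, ‖annih p (annih (p - k) (ψ : Fock))‖ ≤ Real.sqrt (2 * S) * ‖kineticSqrt kF ψ‖ := by
  have hS0 : 0 ≤ S := le_trans (Finset.sum_nonneg fun p hp => (inv_pos.2 (hT p hp)).le) hS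
  have h := Finset.sum_sq_le_sum_mul_sum_of_sq_le_mul T
    (r := fun p => ‖annih p (annih (p - k) (ψ : Fock))‖)
    (f := fun p => (energy kF p + energy kF (p - k))⁻¹)
    (g := fun p => (energy kF p + energy kF (p - k)) *
      ‖annih p (annih (p - k) (ψ : Fock))‖ ^ 2)
    (fun p hp => (inv_pos.2 (hT p hp)).le)
    (fun p hp => mul_nonneg (hT p hp).le (sq_nonneg _))
    (fun p hp => (inv_mul_cancel_left₀ (hT p hp).ne' _).ge)
  refine le_of_sq_le_sq (h.trans ?_) (by positivity)
  rw [mul_pow, Real.sq_sqrt (by positivity)]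
  calc _ ≤ S * (2 * ‖kineticSqrt kF ψ‖ ^ 2) :=
        mul_le_mul hS (sum_pair_energy_le kF k T ψ)
          (Finset.sum_nonneg fun p hp => mul_nonneg (hT p hp).le (sq_nonneg _)) hS0
    _ = _ := by ring

/-! ### Integer points on circles -/

/-- The divisor bound `d(n) ≪ n^ε`. -/
theorem exists_card_divisors_le {ε : ℝ} (hε : 0 < ε) :
    ∃ C : ℝ, 0 < C ∧ ∀ n : ℕ, n ≠ 0 → (n.divisors.card : ℝ) ≤ C * (n : ℝ) ^ ε := by
  have hlog : 0 < Real.log 2 := Real.log_pos one_lt_two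
  -- by multiplicativity it suffices to compare `v + 1` with `p^{v ε}`: primes with `p^ε ≥ 2` cost
  -- nothing, and each of the finitely many others costs a factor `B`
  set B : ℝ := max 1 (1 / (ε * Real.log 2)) with hB
  have hB1 : 1 ≤ B := le_max_left _ _
  obtain ⟨P, hP⟩ := exists_nat_ge ((2 : ℝ) ^ (1 / ε))
  refine ⟨B ^ P, by positivity, fun n hn => ?_⟩
  have hbig : ∀ p : ℕ, P ≤ p → ∀ v : ℕ, ((v : ℝ) + 1) ≤ ((p : ℝ) ^ v) ^ ε := by
    intro p hp v
    have h1 : (2 : ℝ) ≤ (p : ℝ) ^ ε := by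
      have h2 : (2 : ℝ) ^ (1 / ε) ≤ p := hP.trans (by exact_mod_cast hp)
      calc (2 : ℝ) = ((2 : ℝ) ^ (1 / ε)) ^ ε := by
            rw [← Real.rpow_mul (by norm_num), one_div_mul_cancel hε.ne', Real.rpow_one]
        _ ≤ _ := Real.rpow_le_rpow (by positivity) h2 hε.le
    have h3 : ((p : ℝ) ^ v) ^ ε = ((p : ℝ) ^ ε) ^ v := by
      rw [← Real.rpow_natCast, ← Real.rpow_mul (by positivity), mul_comm, Real.rpow_mul
        (by positivity), Real.rpow_natCast]
    rw [h3]
    have h4 : v + 1 ≤ 2 ^ v := Nat.lt_two_pow_self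
    calc ((v : ℝ) + 1) ≤ (2 : ℝ) ^ v := by exact_mod_cast h4
      _ ≤ _ := pow_le_pow_left₀ (by norm_num) h1 v
  have hsmall : ∀ p : ℕ, 2 ≤ p → ∀ v : ℕ, ((v : ℝ) + 1) ≤ B * ((p : ℝ) ^ v) ^ ε := by
    intro p hp v
    have h0 : (1 : ℝ) + v * ε * Real.log 2 ≤ ((p : ℝ) ^ v) ^ ε := by
      have h1 : ((2 : ℝ) ^ v) ^ ε ≤ ((p : ℝ) ^ v) ^ ε := by
        have : (2 : ℝ) ≤ p := by exact_mod_cast hp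
        gcongr
      refine le_trans ?_ h1
      rw [← Real.rpow_natCast, ← Real.rpow_mul (by norm_num),
        Real.rpow_def_of_pos (by norm_num)]
      have := Real.add_one_le_exp (Real.log 2 * ((v : ℝ) * ε))
      linarith
    have hB2 : 1 ≤ B * (ε * Real.log 2) := by
      have h2 : 1 / (ε * Real.log 2) ≤ B := le_max_right _ _
      rwa [div_le_iff₀ (by positivity)] at h2
    calc ((v : ℝ) + 1) ≤ B * (1 + v * ε * Real.log 2) := by
          nlinarith [mul_le_mul_of_nonneg_left hB2 (Nat.cast_nonneg (α := ℝ) v)]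
      _ ≤ _ := by gcongr
  have hn' : (n : ℝ) ^ ε = ∏ p ∈ n.primeFactors, ((p : ℝ) ^ n.factorization p) ^ ε := by
    conv_lhs => rw [← Nat.prod_factorization_pow_eq_self hn]
    rw [Finsupp.prod, Nat.support_factorization]
    push_cast
    exact (Real.finsetProd_rpow _ _ (fun p _ => by positivity) _).symm
  rw [Nat.card_divisors hn, hn']
  push_cast
  calc ∏ p ∈ n.primeFactors, ((n.factorization p : ℝ) + 1)
      ≤ ∏ p ∈ n.primeFactors, ((if p < P then B else 1) *
          ((p : ℝ) ^ n.factorization p) ^ ε) := by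
        refine Finset.prod_le_prod (fun p _ => by positivity) fun p hp => ?_
        split_ifs with h
        · exact hsmall p (Nat.prime_of_mem_primeFactors hp).two_le _
        · rw [one_mul]
          exact hbig p (not_lt.1 h) _
    _ = (∏ p ∈ n.primeFactors, if p < P then B else 1) *
          ∏ p ∈ n.primeFactors, ((p : ℝ) ^ n.factorization p) ^ ε := Finset.prod_mul_distrib
    _ ≤ _ := by
        refine mul_le_mul_of_nonneg_right ?_ (Finset.prod_nonneg fun p _ => by positivity)
        rw [← Finset.prod_filter, Finset.prod_const]
        refine pow_le_pow_right₀ hB1 ?_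
        calc _ ≤ (Finset.range P).card := Finset.card_le_card fun p hp => by
              simpa using (Finset.mem_filter.1 hp).2
          _ = P := Finset.card_range P

/-- The number of primitive solutions of `X² + E Y² = W` is at most `10 d(W)`, uniformly in `E`.
Relative to a fixed solution `(X₀, Y₀)`, the solutions are sorted by `d = gcd(W, X Y₀ - X₀ Y)`.
For two of them with the same `d`, the determinant `X₁ Y₂ - X₂ Y₁` is a multiple of `W / f` with
`f = gcd(d, W / d)`, and `f² ∣ 4 E`; as the determinant is at most `W / √E`, it takes at most five
values. -/
theorem card_primitive_le {E W : ℤ} (hE : 0 < E) (hW : 0 < W) (S : Finset (ℤ × ℤ))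
    (hS : ∀ z ∈ S, z.1 ^ 2 + E * z.2 ^ 2 = W ∧ IsCoprime z.1 z.2) :
    S.card ≤ 10 * W.natAbs.divisors.card := by
  rcases S.eq_empty_or_nonempty with rfl | ⟨z₀, hz₀⟩
  · simp
  obtain ⟨X₀, Y₀⟩ := z₀
  obtain ⟨h0, hc0⟩ := hS _ hz₀
  simp only at h0 hc0
  have hcop : ∀ {X Y : ℤ}, X ^ 2 + E * Y ^ 2 = W → IsCoprime X Y → IsCoprime W Y := by
    intro X Y h hc
    rw [← h]
    have : IsCoprime (X ^ 2) Y := hc.pow_left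
    rw [show X ^ 2 + E * Y ^ 2 = X ^ 2 + Y * (E * Y) by ring]
    exact this.add_mul_left_left _
  have hW0 := hcop h0 hc0
  refine Finset.card_le_mul_card_image_of_maps_to
    (f := fun z : ℤ × ℤ => Int.gcd W (z.1 * Y₀ - X₀ * z.2)) (fun z _ => ?_) 10 ?_
  · rw [Nat.mem_divisors]
    exact ⟨Int.natCast_dvd.1 (Int.gcd_dvd_left ..), by omega⟩
  intro d hd
  rcases Finset.eq_empty_or_nonempty {a ∈ S | Int.gcd W (a.1 * Y₀ - X₀ * a.2) = d} with he |
    ⟨z₁, hz₁⟩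
  · rw [he]; simp
  obtain ⟨d', hdd⟩ : (d : ℤ) ∣ W := by
    rw [Int.natCast_dvd]; exact Nat.dvd_of_mem_divisors hd
  -- the two divisibilities shared by the solutions in a class
  have hdiv : ∀ z ∈ S, Int.gcd W (z.1 * Y₀ - X₀ * z.2) = d →
      (d : ℤ) ∣ z.1 * Y₀ - X₀ * z.2 ∧ d' ∣ z.1 * Y₀ + X₀ * z.2 := by
    intro z hz hzd
    obtain ⟨h1, hc1⟩ := hS z hz
    have hA : (d : ℤ) ∣ z.1 * Y₀ - X₀ * z.2 := hzd ▸ Int.gcd_dvd_right ..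
    refine ⟨hA, ?_⟩
    obtain ⟨a, ha⟩ := hA
    have hd0 : (d : ℤ) ≠ 0 := by rintro h; rw [h] at hdd; omega
    have hcop' : IsCoprime d' a := by
      rw [Int.isCoprime_iff_gcd_eq_one]
      have h2 : Int.gcd (d * d') (d * a) = d := by rw [← hdd, ← ha, hzd]
      rw [Int.gcd_mul_left] at h2
      have h3 : (d : ℤ).natAbs = d := Int.natAbs_natCast d
      rw [h3] at h2
      exact Nat.eq_of_mul_eq_mul_left (by omega) (h2.trans (mul_one d).symm)
    have h4 : (z.1 * Y₀ - X₀ * z.2) * (z.1 * Y₀ + X₀ * z.2) = W * (Y₀ ^ 2 - z.2 ^ 2) := by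
      linear_combination Y₀ ^ 2 * h1 - z.2 ^ 2 * h0
    rw [ha, hdd, mul_assoc, mul_assoc] at h4
    have h5 := mul_left_cancel₀ hd0 h4
    exact hcop'.dvd_of_dvd_mul_left ⟨_, h5⟩
  obtain ⟨hz₁S, hz₁d⟩ := Finset.mem_filter.1 hz₁
  obtain ⟨h1, hc1⟩ := hS _ hz₁S
  obtain ⟨hd1, hd1'⟩ := hdiv _ hz₁S hz₁d
  set f : ℤ := (Int.gcd (d : ℤ) d' : ℤ) with hf
  have hfd : f ∣ d := Int.gcd_dvd_left ..
  have hfd' : f ∣ d' := Int.gcd_dvd_right ..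
  have hffW : f ^ 2 ∣ W := by rw [hdd, pow_two]; exact mul_dvd_mul hfd hfd'
  have hfW : f ∣ W := (dvd_pow_self f two_ne_zero).trans hffW
  have hf0 : f ≠ 0 := by rintro h; rw [h, zero_dvd_iff] at hfW; omega
  have hfE : f ^ 2 ≤ 4 * E := by
    have h2 : f ∣ 2 * X₀ * z₁.2 := by
      have := dvd_sub (hfd'.trans hd1') (hfd.trans hd1)
      rwa [show z₁.1 * Y₀ + X₀ * z₁.2 - (z₁.1 * Y₀ - X₀ * z₁.2) = 2 * X₀ * z₁.2 by ring] at this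
    have h3 : f ∣ 2 * X₀ := ((hcop h1 hc1).of_isCoprime_of_dvd_left hfW).dvd_of_dvd_mul_right h2
    have h4 : f ^ 2 ∣ 4 * E * Y₀ ^ 2 := by
      have h5 := dvd_sub (hffW.mul_left 4) (pow_dvd_pow_of_dvd h3 2)
      rwa [show 4 * W - (2 * X₀) ^ 2 = 4 * E * Y₀ ^ 2 by rw [← h0]; ring] at h5
    exact Int.le_of_dvd (by omega)
      ((IsCoprime.pow_right (hW0.of_isCoprime_of_dvd_left hffW)).dvd_of_dvd_mul_right h4)
  have hdet : ∀ z ∈ S, Int.gcd W (z.1 * Y₀ - X₀ * z.2) = d →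
      W ∣ f * (z₁.1 * z.2 - z.1 * z₁.2) := by
    intro z hz hzd
    obtain ⟨hd2, hd2'⟩ := hdiv z hz hzd
    have hdW : IsCoprime (d : ℤ) Y₀ := hW0.of_isCoprime_of_dvd_left ⟨_, hdd⟩
    have hdW' : IsCoprime d' Y₀ := hW0.of_isCoprime_of_dvd_left ⟨d, by rw [hdd]; ring⟩
    have e1 : (d : ℤ) ∣ z₁.1 * z.2 - z.1 * z₁.2 := by
      refine hdW.dvd_of_dvd_mul_left ?_
      rw [show Y₀ * (z₁.1 * z.2 - z.1 * z₁.2) =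
        (z₁.1 * Y₀ - X₀ * z₁.2) * z.2 - (z.1 * Y₀ - X₀ * z.2) * z₁.2 by ring]
      exact dvd_sub (hd1.mul_right _) (hd2.mul_right _)
    have e2 : d' ∣ z₁.1 * z.2 - z.1 * z₁.2 := by
      refine hdW'.dvd_of_dvd_mul_left ?_
      rw [show Y₀ * (z₁.1 * z.2 - z.1 * z₁.2) =
        (z₁.1 * Y₀ + X₀ * z₁.2) * z.2 - (z.1 * Y₀ + X₀ * z.2) * z₁.2 by ring]
      exact dvd_sub (hd1'.mul_right _) (hd2'.mul_right _)
    rw [hf, Int.gcd_eq_gcd_ab, add_mul, hdd]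
    refine dvd_add ?_ ?_
    · rw [mul_assoc]; exact mul_dvd_mul_left _ (e2.mul_left _)
    · rw [mul_assoc, mul_comm (d : ℤ)]; exact mul_dvd_mul_left _ (e1.mul_left _)
  -- the determinant and the sign of the scalar product with `z₁` determine a solution
  let g : ℤ × ℤ → ℤ × Bool := fun z =>
    (f * (z₁.1 * z.2 - z.1 * z₁.2) / W, decide (0 ≤ z₁.1 * z.1 + E * z₁.2 * z.2))
  have hid : ∀ z ∈ S, (z₁.1 * z.1 + E * z₁.2 * z.2) ^ 2 +
      E * (z₁.1 * z.2 - z.1 * z₁.2) ^ 2 = W ^ 2 := by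
    intro z hz
    obtain ⟨h2, -⟩ := hS z hz
    linear_combination (z.1 ^ 2 + E * z.2 ^ 2) * h1 + W * h2
  have hcard : (Finset.Icc (-2 : ℤ) 2 ×ˢ (Finset.univ : Finset Bool)).card = 10 := by decide
  rw [← hcard]
  refine Finset.card_le_card_of_injOn g ?_ ?_
  · intro z hz
    obtain ⟨hzS, hzd⟩ := Finset.mem_filter.1 (Finset.mem_coe.1 hz)
    obtain ⟨j, hj⟩ := hdet z hzS hzd
    have h3 := hid z hzS
    have hj2 : j ^ 2 ≤ 2 ^ 2 := by
      have h4 : (W * j) ^ 2 ≤ 4 * W ^ 2 := by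
        rw [← hj, ← h3]
        nlinarith [mul_le_mul_of_nonneg_right hfE (sq_nonneg (z₁.1 * z.2 - z.1 * z₁.2)),
          sq_nonneg (z₁.1 * z.1 + E * z₁.2 * z.2)]
      have h5 : W ^ 2 * j ^ 2 ≤ W ^ 2 * 2 ^ 2 := by linarith
      exact le_of_mul_le_mul_left h5 (by positivity)
    have h6 := abs_le_of_sq_le_sq' hj2 (by norm_num)
    simp only [g, hj, Int.mul_ediv_cancel_left _ hW.ne', Finset.coe_product, Set.mem_prod,
      Finset.coe_Icc, Set.mem_Icc, Finset.coe_univ, Set.mem_univ, and_true]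
    exact h6
  · intro z hz z' hz' hzz
    obtain ⟨hzS, hzd⟩ := Finset.mem_filter.1 (Finset.mem_coe.1 hz)
    obtain ⟨hzS', hzd'⟩ := Finset.mem_filter.1 (Finset.mem_coe.1 hz')
    obtain ⟨j, hj⟩ := hdet z hzS hzd
    obtain ⟨j', hj'⟩ := hdet z' hzS' hzd'
    simp only [g, hj, hj', Int.mul_ediv_cancel_left _ hW.ne', Prod.mk.injEq,
      decide_eq_decide] at hzz
    obtain ⟨rfl, hs⟩ := hzz
    have hcr : z₁.1 * z.2 - z.1 * z₁.2 = z₁.1 * z'.2 - z'.1 * z₁.2 :=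
      mul_left_cancel₀ hf0 (hj.trans hj'.symm)
    have hdot : z₁.1 * z.1 + E * z₁.2 * z.2 = z₁.1 * z'.1 + E * z₁.2 * z'.2 := by
      have h3 := hid z hzS
      have h4 := hid z' hzS'
      rw [← hcr, ← h3] at h4
      have h5 := sq_eq_sq_iff_eq_or_eq_neg.1 (add_right_cancel h4)
      by_cases hp : 0 ≤ z₁.1 * z.1 + E * z₁.2 * z.2
      · have := hs.1 hp
        omega
      · have := mt hs.2 hp
        omega
    have hx : W * z.1 = W * z'.1 := by
      rw [← h1]; linear_combination z₁.1 * hdot - E * z₁.2 * hcr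
    have hy : W * z.2 = W * z'.2 := by
      rw [← h1]; linear_combination z₁.2 * hdot + z₁.1 * hcr
    exact Prod.ext (mul_left_cancel₀ hW.ne' hx) (mul_left_cancel₀ hW.ne' hy)

/-- The number of solutions of `X² + E Y² = W`, uniformly in `E`: the solutions with greatest
common divisor `g` correspond to primitive solutions for `W / g²`. -/
theorem card_form_le {E W : ℤ} (hE : 0 < E) (hW : 0 < W) (S : Finset (ℤ × ℤ))
    (hS : ∀ z ∈ S, z.1 ^ 2 + E * z.2 ^ 2 = W) :
    S.card ≤ 10 * W.natAbs.divisors.card ^ 2 := by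
  have hsq : ∀ z ∈ S, ((Int.gcd z.1 z.2 : ℤ)) ^ 2 ∣ W := by
    intro z hz
    rw [← hS z hz]
    refine dvd_add (pow_dvd_pow_of_dvd (Int.gcd_dvd_left ..) 2)
      (Dvd.dvd.mul_left (pow_dvd_pow_of_dvd (Int.gcd_dvd_right ..) 2) _)
  rw [pow_two, ← mul_assoc]
  refine Finset.card_le_mul_card_image_of_maps_to
    (f := fun z : ℤ × ℤ => Int.gcd z.1 z.2) (fun z hz => ?_) _ ?_
  · rw [Nat.mem_divisors]
    exact ⟨Int.natCast_dvd.1 ((dvd_pow_self _ two_ne_zero).trans (hsq z hz)), by omega⟩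
  intro d hd
  rcases Finset.eq_empty_or_nonempty {a ∈ S | Int.gcd a.1 a.2 = d} with he | ⟨z₁, hz₁⟩
  · rw [he]; simp
  obtain ⟨hz₁S, hz₁d⟩ := Finset.mem_filter.1 hz₁
  obtain ⟨W', hW'⟩ := hsq _ hz₁S
  rw [hz₁d] at hW'
  have hd0 : (0 : ℤ) < d := by
    rcases Nat.eq_zero_or_pos d with rfl | h
    · simp at hW'; omega
    · exact_mod_cast h
  have hW'0 : 0 < W' := by
    rw [hW'] at hW
    exact pos_of_mul_pos_right hW (by positivity)
  have hle : W'.natAbs.divisors.card ≤ W.natAbs.divisors.card := by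
    refine Finset.card_le_card (Nat.divisors_subset_of_dvd (by omega) ?_)
    rw [Int.natAbs_dvd_natAbs]
    exact ⟨_, by rw [hW', mul_comm]⟩
  have hdvd : ∀ z ∈ ({a ∈ S | Int.gcd a.1 a.2 = d} : Finset (ℤ × ℤ)),
      (d : ℤ) * (z.1 / d) = z.1 ∧ (d : ℤ) * (z.2 / d) = z.2 := by
    intro z hz
    obtain ⟨-, hzd⟩ := Finset.mem_filter.1 hz
    exact ⟨Int.mul_ediv_cancel' (hzd ▸ Int.gcd_dvd_left ..),
      Int.mul_ediv_cancel' (hzd ▸ Int.gcd_dvd_right ..)⟩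
  have hinj : Set.InjOn (fun z : ℤ × ℤ => (z.1 / (d : ℤ), z.2 / (d : ℤ)))
      ({a ∈ S | Int.gcd a.1 a.2 = d} : Finset (ℤ × ℤ)) := by
    intro z hz z' hz' h
    obtain ⟨a1, a2⟩ := hdvd z hz
    obtain ⟨b1, b2⟩ := hdvd z' hz'
    obtain ⟨c1, c2⟩ := Prod.mk.inj h
    exact Prod.ext (by rw [← a1, ← b1, c1]) (by rw [← a2, ← b2, c2])
  rw [← Finset.card_image_of_injOn hinj]
  refine (card_primitive_le hE hW'0 _ ?_).trans (Nat.mul_le_mul_left _ hle)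
  intro y hy
  obtain ⟨z, hz, rfl⟩ := Finset.mem_image.1 hy
  obtain ⟨a1, a2⟩ := hdvd z hz
  obtain ⟨hzS, hzd⟩ := Finset.mem_filter.1 hz
  refine ⟨?_, ?_⟩
  · have h := hS z hzS
    rw [← a1, ← a2, hW'] at h
    refine mul_left_cancel₀ (pow_ne_zero 2 hd0.ne') (Eq.trans ?_ h)
    ring
  · simp only
    rw [Int.isCoprime_iff_gcd_eq_one, ← hzd]
    exact Int.gcd_ediv_gcd_ediv_gcd (by rw [hzd]; exact_mod_cast hd0)

/-- For `k ≠ 0` there are orthogonal integer vectors `w`, `w' = k × w` in the plane `k^⊥`, with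
`|w| ≤ |k|`. They turn the equation `p² = n` in a plane `p·k = h` into a binary form. -/
theorem exists_orthogonal_frame {k : Mom} (hk : k ≠ 0) : ∃ w w' : Mom, 0 < w ⬝ᵥ w ∧
    w ⬝ᵥ w ≤ k ⬝ᵥ k ∧ ∀ p : Mom, (k ⬝ᵥ k) * (w ⬝ᵥ w) * (p ⬝ᵥ p) =
      (w ⬝ᵥ w) * (p ⬝ᵥ k) ^ 2 + (k ⬝ᵥ k) * (p ⬝ᵥ w) ^ 2 + (p ⬝ᵥ w') ^ 2 := by
  simp only [Matrix.vec3_dotProduct]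
  by_cases h : k 0 = 0 ∧ k 1 = 0
  · refine ⟨![1, 0, 0], ![0, k 2, 0], by simp, ?_, fun p => ?_⟩
    · have h2 : k 2 ≠ 0 := by
        intro h2
        refine hk (funext fun i => ?_)
        fin_cases i
        · exact h.1
        · exact h.2
        · exact h2
      have := mul_self_pos.2 h2
      simp [h.1, h.2]
      omega
    · simp [h.1, h.2]
      ring
  · refine ⟨![k 1, -k 0, 0], ![k 0 * k 2, k 1 * k 2, -(k 0 ^ 2 + k 1 ^ 2)], ?_, ?_, fun p => ?_⟩
    · simp only [Matrix.cons_val_zero, Matrix.cons_val_one, Matrix.cons_val]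
      by_cases h0 : k 0 = 0
      · have h1 : k 1 ≠ 0 := fun h1 => h ⟨h0, h1⟩
        nlinarith [sq_nonneg (k 0), mul_self_pos.2 h1]
      · nlinarith [sq_nonneg (k 1), mul_self_pos.2 h0]
    · simp only [Matrix.cons_val_zero, Matrix.cons_val_one, Matrix.cons_val]
      nlinarith [sq_nonneg (k 2)]
    · simp only [Matrix.cons_val_zero, Matrix.cons_val_one, Matrix.cons_val]
      ring

theorem dotProduct_self_pos {p : Mom} (hp : p ≠ 0) : 0 < p ⬝ᵥ p :=
  lt_of_le_of_ne (Finset.sum_nonneg fun _ _ => mul_self_nonneg _)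
    fun h => hp (dotProduct_self_eq_zero.1 h.symm)

/-- A circle of radius `≪ R` in a plane with normal vector of size `≪ R` carries `≪ R^ε` integer
points, uniformly in the plane and the circle. -/
theorem exists_card_circle_le {ε : ℝ} (hε : 0 < ε) : ∃ C : ℝ, 0 < C ∧ ∀ R : ℝ, 1 ≤ R →
    ∀ k : Mom, k ≠ 0 → ((k ⬝ᵥ k : ℤ) : ℝ) ≤ 9 * R ^ 2 → ∀ n h : ℤ, (n : ℝ) ≤ 2 * R ^ 2 →
    ∀ S : Finset Mom, (∀ p ∈ S, p ⬝ᵥ k = h ∧ p ⬝ᵥ p = n) → (S.card : ℝ) ≤ C * R ^ ε := by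
  obtain ⟨C, hC, hdiv⟩ := exists_card_divisors_le (ε := ε / 12) (by positivity)
  refine ⟨max 1 (10 * (C * (162 : ℝ) ^ (ε / 12)) ^ 2), by positivity,
    fun R hR k hk hkR n h hn S hS => ?_⟩
  obtain ⟨w, w', hw, hwk, hid⟩ := exists_orthogonal_frame hk
  have hk0 := dotProduct_self_pos hk
  have hRε : 1 ≤ R ^ ε := Real.one_le_rpow hR hε.le
  set W : ℤ := (w ⬝ᵥ w) * ((k ⬝ᵥ k) * n - h ^ 2) with hW
  have hform : ∀ p ∈ S, (p ⬝ᵥ w') ^ 2 + (k ⬝ᵥ k) * (p ⬝ᵥ w) ^ 2 = W := by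
    intro p hp
    obtain ⟨h1, h2⟩ := hS p hp
    have := hid p
    rw [h1, h2] at this
    rw [hW]; linear_combination -this
  have hinj : Set.InjOn (fun p : Mom => (p ⬝ᵥ w', p ⬝ᵥ w)) S := by
    intro p hp q hq hpq
    obtain ⟨e1, e2⟩ := Prod.mk.inj hpq
    have e3 : p ⬝ᵥ k = q ⬝ᵥ k := (hS p hp).1.trans (hS q hq).1.symm
    by_contra hne
    have := dotProduct_self_pos (sub_ne_zero.2 hne)
    have hpos : 0 < (k ⬝ᵥ k) * (w ⬝ᵥ w) * ((p - q) ⬝ᵥ (p - q)) := by positivity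
    rw [hid (p - q), sub_dotProduct p q k, sub_dotProduct p q w, sub_dotProduct p q w', e1, e2,
      e3] at hpos
    simp at hpos
  rcases le_or_gt W 0 with hW0 | hW0
  · have hone : S.card ≤ 1 := by
      refine Finset.card_le_one.2 fun p hp q hq => hinj hp hq ?_
      have hz : ∀ p ∈ S, p ⬝ᵥ w' = 0 ∧ p ⬝ᵥ w = 0 := by
        intro p hp
        have h1 := hform p hp
        have h2 := sq_nonneg (p ⬝ᵥ w')
        have h3 : 0 ≤ (k ⬝ᵥ k) * (p ⬝ᵥ w) ^ 2 := by positivity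
        have h4 : (k ⬝ᵥ k) * (p ⬝ᵥ w) ^ 2 = 0 := by omega
        have h5 : (p ⬝ᵥ w') ^ 2 = 0 := by omega
        refine ⟨pow_eq_zero_iff two_ne_zero |>.1 h5, ?_⟩
        rcases mul_eq_zero.1 h4 with h6 | h6
        · omega
        · exact pow_eq_zero_iff two_ne_zero |>.1 h6
      simp only [(hz p hp).1, (hz p hp).2, (hz q hq).1, (hz q hq).2]
    calc (S.card : ℝ) ≤ 1 := by exact_mod_cast hone
      _ ≤ 1 * R ^ ε := by linarith
      _ ≤ _ := by gcongr; exact le_max_left _ _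
  have hcard : S.card ≤ 10 * W.natAbs.divisors.card ^ 2 := by
    rw [← Finset.card_image_of_injOn hinj]
    refine card_form_le hk0 hW0 _ fun z hz => ?_
    obtain ⟨p, hp, rfl⟩ := Finset.mem_image.1 hz
    exact hform p hp
  have hWR : (W : ℝ) ≤ 162 * R ^ 6 := by
    have h1 : W ≤ (w ⬝ᵥ w) * ((k ⬝ᵥ k) * n) := by
      rw [hW]; nlinarith [mul_nonneg hw.le (sq_nonneg h)]
    have hn0 : 0 ≤ n := by
      by_contra hneg
      have : (k ⬝ᵥ k) * n < 0 := mul_neg_of_pos_of_neg hk0 (not_le.1 hneg)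
      nlinarith
    have h2 : W ≤ (k ⬝ᵥ k) * ((k ⬝ᵥ k) * n) :=
      h1.trans (mul_le_mul_of_nonneg_right hwk (by positivity))
    have h3 : (W : ℝ) ≤ ((k ⬝ᵥ k : ℤ) : ℝ) * (((k ⬝ᵥ k : ℤ) : ℝ) * n) := by exact_mod_cast h2
    have hk0' : (0 : ℝ) ≤ ((k ⬝ᵥ k : ℤ) : ℝ) := by exact_mod_cast hk0.le
    have hn0' : (0 : ℝ) ≤ n := by exact_mod_cast hn0
    calc (W : ℝ) ≤ (9 * R ^ 2) * ((9 * R ^ 2) * (2 * R ^ 2)) := h3.trans (by gcongr)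
      _ = _ := by ring
  have hd := hdiv W.natAbs (by omega)
  have hWabs : ((W.natAbs : ℕ) : ℝ) = W := by
    rw [Nat.cast_natAbs, abs_of_pos hW0]
  rw [hWabs] at hd
  have hd2 : (W.natAbs.divisors.card : ℝ) ≤ C * 162 ^ (ε / 12) * R ^ (ε / 2) := by
    have hW0' : (0 : ℝ) ≤ W := by exact_mod_cast hW0.le
    calc _ ≤ C * (162 * R ^ 6) ^ (ε / 12) := hd.trans (by gcongr)
      _ = _ := by
        rw [Real.mul_rpow (by norm_num) (by positivity), ← Real.rpow_natCast,
          ← Real.rpow_mul (by positivity), mul_assoc]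
        congr 3
        push_cast; ring
  calc (S.card : ℝ) ≤ 10 * (W.natAbs.divisors.card : ℝ) ^ 2 := by exact_mod_cast hcard
    _ ≤ 10 * (C * 162 ^ (ε / 12) * R ^ (ε / 2)) ^ 2 := by gcongr
    _ = 10 * (C * 162 ^ (ε / 12)) ^ 2 * R ^ ε := by
      rw [mul_pow, ← Real.rpow_natCast (R ^ (ε / 2)), ← Real.rpow_mul (by positivity)]
      rw [mul_assoc]
      congr 3
      push_cast; ring
    _ ≤ _ := by gcongr; exact le_max_right _ _

/-! ### The pairs `(p, p - k)` across the Fermi surface -/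

theorem normSq_eq_dotProduct (p : Mom) : normSq p = ((p ⬝ᵥ p : ℤ) : ℝ) := by
  simp [normSq, dotProduct, pow_two]

theorem mem_fermiBall {kF : ℝ} (hkF : 0 ≤ kF) (p : Mom) :
    p ∈ fermiBall kF ↔ normSq p ≤ kF ^ 2 := by
  simp [fermiBall, Real.sqrt_le_left hkF]

theorem mem_pairSet {kF : ℝ} (hkF : 0 ≤ kF) (k p : Mom) :
    p ∈ pairSet kF k ↔ normSq (p - k) ≤ kF ^ 2 ∧ kF ^ 2 < normSq p := by
  rw [pairSet, Finset.mem_sdiff, mem_fermiBall hkF, not_le, ← mem_fermiBall hkF]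
  refine and_congr_left fun _ => ?_
  rw [Finset.mem_image]
  exact ⟨by rintro ⟨q, hq, rfl⟩; simpa using hq, fun h => ⟨p - k, h, by simp⟩⟩

/-- The energy gap `p² - (p - k)²` in units of `ħ²`. -/
def gap (k p : Mom) : ℤ := p ⬝ᵥ p - (p - k) ⬝ᵥ (p - k)

theorem gap_eq (k p : Mom) : gap k p = 2 * (p ⬝ᵥ k) - k ⬝ᵥ k := by
  rw [gap, sub_dotProduct, dotProduct_sub, dotProduct_sub, dotProduct_comm k p]
  ring

theorem gap_cast (k p : Mom) : (gap k p : ℝ) = normSq p - normSq (p - k) := by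
  rw [gap, normSq_eq_dotProduct, normSq_eq_dotProduct]
  push_cast; ring

theorem one_le_gap {kF : ℝ} (hkF : 0 ≤ kF) {k p : Mom} (hp : p ∈ pairSet kF k) : 1 ≤ gap k p := by
  obtain ⟨h1, h2⟩ := (mem_pairSet hkF k p).1 hp
  have : (0 : ℝ) < gap k p := by rw [gap_cast]; linarith
  have : 0 < gap k p := by exact_mod_cast this
  omega

theorem pairSet_zero {kF : ℝ} (hkF : 0 ≤ kF) : pairSet kF 0 = ∅ := by
  refine Finset.eq_empty_of_forall_notMem fun p hp => ?_
  have := one_le_gap hkF hp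
  simp [gap] at this

/-- Pairs with gap at most `√R` are controlled by the number of integer points on circles: a fixed
gap `m` leaves `m` values for `p²`. -/
theorem exists_sum_gap_small_le {ε : ℝ} (hε : 0 < ε) : ∃ C : ℝ, 0 < C ∧ ∀ R : ℝ, 1 ≤ R →
    ∀ k : Mom, normSq k ≤ 9 * R ^ 2 →
    ∑ p ∈ pairSet R k with (gap k p : ℝ) ≤ Real.sqrt R, (gap k p : ℝ)⁻¹ ≤
      C * R ^ (1 / 2 + ε) := by
  obtain ⟨C, hC, hcirc⟩ := exists_card_circle_le hε
  refine ⟨C, hC, fun R hR k hkR => ?_⟩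
  have hR0 : 0 ≤ R := by linarith
  rcases eq_or_ne k 0 with rfl | hk
  · rw [pairSet_zero hR0, Finset.filter_empty, Finset.sum_empty]
    positivity
  set T := (pairSet R k).filter fun p => (gap k p : ℝ) ≤ Real.sqrt R with hT
  have hmaps : ∀ p ∈ T, gap k p ∈ Finset.Icc 1 ⌊Real.sqrt R⌋ := by
    intro p hp
    obtain ⟨h1, h2⟩ := Finset.mem_filter.1 hp
    exact Finset.mem_Icc.2 ⟨one_le_gap hR0 h1, Int.le_floor.2 h2⟩
  rw [← Finset.sum_fiberwise_of_maps_to hmaps]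
  have hlayer : ∀ m ∈ Finset.Icc (1 : ℤ) ⌊Real.sqrt R⌋,
      ∑ p ∈ T with gap k p = m, (gap k p : ℝ)⁻¹ ≤ C * R ^ ε := by
    intro m hm
    obtain ⟨hm1, hm2⟩ := Finset.mem_Icc.1 hm
    have hm0 : (0 : ℝ) < m := by exact_mod_cast hm1
    have hmR : (m : ℝ) ≤ R ^ 2 := by
      have h1 := Int.le_floor.1 hm2
      have h2 : Real.sqrt R ≤ R := by
        rw [Real.sqrt_le_left hR0]; nlinarith
      nlinarith
    have hsum : ∑ p ∈ T with gap k p = m, (gap k p : ℝ)⁻¹ =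
        ((T.filter fun p => gap k p = m).card : ℝ) * (m : ℝ)⁻¹ := by
      rw [Finset.sum_congr rfl (g := fun _ => (m : ℝ)⁻¹), Finset.sum_const, nsmul_eq_mul]
      intro p hp
      rw [(Finset.mem_filter.1 hp).2]
    have hmaps2 : ∀ p ∈ T.filter fun p => gap k p = m,
        p ⬝ᵥ p ∈ Finset.Ioc ⌊R ^ 2⌋ (⌊R ^ 2⌋ + m) := by
      intro p hp
      obtain ⟨h1, h2⟩ := Finset.mem_filter.1 hp
      obtain ⟨h3, h4⟩ := (mem_pairSet hR0 k p).1 (Finset.mem_filter.1 h1).1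
      rw [normSq_eq_dotProduct] at h3 h4
      refine Finset.mem_Ioc.2 ⟨Int.floor_lt.2 h4, ?_⟩
      have := Int.le_floor.2 h3
      rw [gap] at h2
      omega
    have hfib : ∀ n ∈ Finset.Ioc ⌊R ^ 2⌋ (⌊R ^ 2⌋ + m),
        ((({p ∈ T.filter fun p => gap k p = m | p ⬝ᵥ p = n} : Finset Mom).card : ℕ) : ℝ) ≤
          C * R ^ ε := by
      intro n hn
      refine hcirc R hR k hk (by rwa [← normSq_eq_dotProduct]) n ((k ⬝ᵥ k + m) / 2) ?_ _ ?_
      · have h1 := (Finset.mem_Ioc.1 hn).2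
        have h2 : (n : ℝ) ≤ ⌊R ^ 2⌋ + m := by exact_mod_cast h1
        have := Int.floor_le (R ^ 2)
        linarith
      · intro p hp
        obtain ⟨h1, h2⟩ := Finset.mem_filter.1 hp
        refine ⟨?_, h2⟩
        have h3 := (Finset.mem_filter.1 h1).2
        rw [gap_eq] at h3
        omega
    have hcard : ((T.filter fun p => gap k p = m).card : ℝ) ≤ m * (C * R ^ ε) := by
      rw [Finset.card_eq_sum_card_fiberwise hmaps2]
      push_cast
      refine (Finset.sum_le_sum hfib).trans ?_
      rw [Finset.sum_const, nsmul_eq_mul, Int.card_Ioc]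
      have : (((⌊R ^ 2⌋ + m - ⌊R ^ 2⌋).toNat : ℕ) : ℝ) = m := by
        rw [add_sub_cancel_left]
        exact_mod_cast congrArg (Int.cast : ℤ → ℝ) (Int.toNat_of_nonneg (by omega : 0 ≤ m))
      rw [this]
    rw [hsum, ← div_eq_mul_inv, div_le_iff₀ hm0]
    linarith
  refine (Finset.sum_le_sum hlayer).trans ?_
  rw [Finset.sum_const, nsmul_eq_mul, Int.card_Icc, add_sub_cancel_right]
  have h1 : ((⌊Real.sqrt R⌋.toNat : ℕ) : ℝ) ≤ Real.sqrt R := by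
    have h2 : ((⌊Real.sqrt R⌋.toNat : ℕ) : ℝ) = ⌊Real.sqrt R⌋ := by
      exact_mod_cast congrArg (Int.cast : ℤ → ℝ)
        (Int.toNat_of_nonneg (Int.floor_nonneg.2 (Real.sqrt_nonneg R)))
    rw [h2]; exact Int.floor_le _
  calc _ ≤ Real.sqrt R * (C * R ^ ε) := by gcongr
    _ = _ := by
      rw [Real.rpow_add (by linarith), Real.sqrt_eq_rpow]; ring

/-! ### Integer points near circles, in a rotated frame -/

theorem card_le_mul_card_image_of_fiber {α β : Type*} [DecidableEq β] (S : Finset α) (f : α → β)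
    (B : ℝ) (h : ∀ a ∈ S, ((S.filter fun a' => f a' = f a).card : ℝ) ≤ B) :
    (S.card : ℝ) ≤ B * (S.image f).card := by
  rw [Finset.card_eq_sum_card_image f S]
  push_cast
  rw [mul_comm, ← nsmul_eq_mul]
  refine Finset.sum_le_card_nsmul _ _ _ fun b hb => ?_
  obtain ⟨a, ha, rfl⟩ := Finset.mem_image.1 hb
  exact h a ha

theorem card_floor_le {a J : ℝ} (hJ : 0 ≤ J) : ((Finset.Icc ⌊a⌋ ⌊a + J⌋).card : ℝ) ≤ J + 2 := by
  rw [Int.card_Icc]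
  have h0 : ⌊a⌋ ≤ ⌊a + J⌋ := Int.floor_mono (by linarith)
  have h1 : (((⌊a + J⌋ + 1 - ⌊a⌋).toNat : ℕ) : ℝ) = ⌊a + J⌋ + 1 - ⌊a⌋ := by
    exact_mod_cast congrArg (Int.cast : ℤ → ℝ)
      (Int.toNat_of_nonneg (by omega : 0 ≤ ⌊a + J⌋ + 1 - ⌊a⌋))
  rw [h1]
  have := Int.floor_le (a + J)
  have := Int.lt_floor_add_one a
  linarith

theorem abs_sub_le_one_of_floor_eq {a b : ℝ} (h : ⌊a⌋ = ⌊b⌋) : |a - b| ≤ 1 :=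
  (Int.abs_sub_lt_one_of_floor_eq_floor h).le

/-- Additive coordinates on `ℤ³` with respect to some orthonormal frame of `ℝ³`. -/
structure Frame where
  /-- the axial coordinate -/
  t : Mom → ℝ
  /-- the first transversal coordinate -/
  x : Mom → ℝ
  /-- the second transversal coordinate -/
  y : Mom → ℝ
  t_sub : ∀ p q, t (p - q) = t p - t q
  x_sub : ∀ p q, x (p - q) = x p - x q
  y_sub : ∀ p q, y (p - q) = y p - y q
  normSq_eq : ∀ p, normSq p = t p ^ 2 + x p ^ 2 + y p ^ 2

namespace Frame

/-- The squared length of the transversal component. -/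
def perpSq (F : Frame) (p : Mom) : ℝ := F.x p ^ 2 + F.y p ^ 2

theorem perpSq_nonneg (F : Frame) (p : Mom) : 0 ≤ F.perpSq p :=
  add_nonneg (sq_nonneg _) (sq_nonneg _)

/-- Rotation of the transversal coordinates. -/
def rot (F : Frame) (a b : ℝ) (h : a ^ 2 + b ^ 2 = 1) : Frame where
  t := F.t
  x p := a * F.x p + b * F.y p
  y p := a * F.y p - b * F.x p
  t_sub := F.t_sub
  x_sub p q := by rw [F.x_sub, F.y_sub]; ring
  y_sub p q := by rw [F.x_sub, F.y_sub]; ring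
  normSq_eq p := by
    rw [F.normSq_eq]; linear_combination (-(F.x p ^ 2 + F.y p ^ 2)) * h

theorem perpSq_rot (F : Frame) (a b : ℝ) (h : a ^ 2 + b ^ 2 = 1) (p : Mom) :
    (F.rot a b h).perpSq p = F.perpSq p := by
  simp only [perpSq, rot]; linear_combination (F.x p ^ 2 + F.y p ^ 2) * h

/-- Points in a unit box of the frame differ by vectors of squared length at most three, hence by
vectors with entries `-1, 0, 1`. -/
theorem card_unit_box_le (F : Frame) (S : Finset Mom)
    (hS : ∀ p ∈ S, ∀ q ∈ S, |F.t p - F.t q| ≤ 1 ∧ |F.x p - F.x q| ≤ 1 ∧ |F.y p - F.y q| ≤ 1) :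
    S.card ≤ 27 := by
  rcases S.eq_empty_or_nonempty with rfl | ⟨q, hq⟩
  · simp
  have hcard : (Fintype.piFinset fun _ : Fin 3 => Finset.Icc (-1 : ℤ) 1).card = 27 := by
    rw [Fintype.card_piFinset]; simp
  rw [← hcard]
  refine Finset.card_le_card_of_injOn (fun p => p - q) ?_ (fun a _ b _ h => sub_left_injective h)
  intro p hp
  obtain ⟨h1, h2, h3⟩ := hS p hp q hq
  rw [← F.t_sub] at h1
  rw [← F.x_sub] at h2
  rw [← F.y_sub] at h3
  have h4 := F.normSq_eq (p - q)
  have h5 : normSq (p - q) ≤ 3 := by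
    rw [h4]
    have := sq_le_one_iff_abs_le_one _ |>.2 h1
    have := sq_le_one_iff_abs_le_one _ |>.2 h2
    have := sq_le_one_iff_abs_le_one _ |>.2 h3
    linarith
  rw [Finset.mem_coe, Fintype.mem_piFinset]
  intro i
  have h6 : (((p - q) i : ℤ) : ℝ) ^ 2 ≤ normSq (p - q) :=
    Finset.single_le_sum (f := fun i => (((p - q) i : ℤ) : ℝ) ^ 2) (fun j _ => sq_nonneg _)
      (Finset.mem_univ i)
  have h7 : ((p - q) i) ^ 2 ≤ 3 := by exact_mod_cast h6.trans h5
  rw [Finset.mem_Icc]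
  constructor <;> nlinarith

theorem card_box_le (F : Frame) (S : Finset Mom) {t₀ x₀ y₀ J s r : ℝ} (hJ : 0 ≤ J) (hs : 0 ≤ s)
    (hr : 0 ≤ r) (ht : ∀ p ∈ S, t₀ ≤ F.t p ∧ F.t p ≤ t₀ + J)
    (hx : ∀ p ∈ S, x₀ ≤ F.x p ∧ F.x p ≤ x₀ + s) (hy : ∀ p ∈ S, y₀ ≤ F.y p ∧ F.y p ≤ y₀ + r) :
    (S.card : ℝ) ≤ 27 * ((J + 2) * ((s + 2) * (r + 2))) := by
  refine (card_le_mul_card_image_of_fiber S (fun p => (⌊F.t p⌋, ⌊F.x p⌋, ⌊F.y p⌋)) 27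
    fun a _ => ?_).trans ?_
  · have := F.card_unit_box_le
      (S.filter fun a' => (⌊F.t a'⌋, ⌊F.x a'⌋, ⌊F.y a'⌋) = (⌊F.t a⌋, ⌊F.x a⌋, ⌊F.y a⌋)) ?_
    · exact_mod_cast this
    intro p hp q hq
    have h1 := (Finset.mem_filter.1 hp).2.trans (Finset.mem_filter.1 hq).2.symm
    simp only [Prod.mk.injEq] at h1
    exact ⟨abs_sub_le_one_of_floor_eq h1.1, abs_sub_le_one_of_floor_eq h1.2.1,
      abs_sub_le_one_of_floor_eq h1.2.2⟩
  · refine mul_le_mul_of_nonneg_left ?_ (by norm_num)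
    have hsub : S.image (fun p => (⌊F.t p⌋, ⌊F.x p⌋, ⌊F.y p⌋)) ⊆
        Finset.Icc ⌊t₀⌋ ⌊t₀ + J⌋ ×ˢ (Finset.Icc ⌊x₀⌋ ⌊x₀ + s⌋ ×ˢ Finset.Icc ⌊y₀⌋ ⌊y₀ + r⌋) := by
      intro z hz
      obtain ⟨p, hp, rfl⟩ := Finset.mem_image.1 hz
      simp only [Finset.mem_product, Finset.mem_Icc]
      exact ⟨⟨Int.floor_mono (ht p hp).1, Int.floor_mono (ht p hp).2⟩,
        ⟨Int.floor_mono (hx p hp).1, Int.floor_mono (hx p hp).2⟩,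
        ⟨Int.floor_mono (hy p hp).1, Int.floor_mono (hy p hp).2⟩⟩
    have h1 := Finset.card_le_card hsub
    rw [Finset.card_product, Finset.card_product] at h1
    refine (Nat.cast_le (α := ℝ).2 h1).trans ?_
    push_cast
    have h2 := card_floor_le (a := t₀) hJ
    have h3 := card_floor_le (a := x₀) hs
    have h4 := card_floor_le (a := y₀) hr
    gcongr

/-- Points of an annulus with bounded first coordinate whose second coordinate is bounded below:
over each unit interval of `x`, the coordinate `y` varies by at most `(W + 2s) / (2ρ)`. -/
theorem card_strip_le (F : Frame) (S : Finset Mom) {t₀ J s ρ X W : ℝ} (hJ : 1 ≤ J) (hs : 0 ≤ s)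
    (hρ : 0 < ρ) (hW : 0 ≤ W) (ht : ∀ p ∈ S, t₀ ≤ F.t p ∧ F.t p ≤ t₀ + J)
    (hx : ∀ p ∈ S, |F.x p| ≤ s) (hy : ∀ p ∈ S, ρ ≤ F.y p)
    (hq : ∀ p ∈ S, X ≤ F.perpSq p ∧ F.perpSq p ≤ X + W) :
    (S.card : ℝ) ≤ 243 * J * ((2 * s + 2) * ((W + 2 * s) / (2 * ρ) + 2)) := by
  have hy0 : 0 ≤ (W + 2 * s) / (2 * ρ) := by positivity
  refine (card_le_mul_card_image_of_fiber S (fun p => ⌊F.x p⌋)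
    (243 * J * ((W + 2 * s) / (2 * ρ) + 2)) fun a ha => ?_).trans ?_
  · set S' := S.filter fun a' => ⌊F.x a'⌋ = ⌊F.x a⌋ with hS'
    have hne : S'.Nonempty := ⟨a, Finset.mem_filter.2 ⟨ha, rfl⟩⟩
    obtain ⟨b, hb, hmin⟩ := S'.exists_min_image F.y hne
    have hmem : ∀ p ∈ S', p ∈ S := fun p hp => (Finset.mem_filter.1 hp).1
    refine (F.card_box_le S' (t₀ := t₀) (J := J) (x₀ := ⌊F.x a⌋) (s := 1) (y₀ := F.y b)
      (r := (W + 2 * s) / (2 * ρ)) (by linarith) zero_le_one hy0 (fun p hp => ht p (hmem p hp))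
      (fun p hp => ?_) (fun p hp => ⟨hmin p hp, ?_⟩)).trans ?_
    · rw [← (Finset.mem_filter.1 hp).2]
      exact ⟨Int.floor_le _, (Int.lt_floor_add_one _).le⟩
    · have h1 : |F.x p - F.x b| ≤ 1 := abs_sub_le_one_of_floor_eq
        ((Finset.mem_filter.1 hp).2.trans (Finset.mem_filter.1 hb).2.symm)
      have h2 := (hq p (hmem p hp)).2
      have h3 := (hq b (hmem b hb)).1
      simp only [perpSq] at h2 h3
      have h4 : F.x b ^ 2 - F.x p ^ 2 ≤ 2 * s := by
        have h5 : |F.x b + F.x p| ≤ 2 * s :=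
          (abs_add_le _ _).trans (by linarith [hx b (hmem b hb), hx p (hmem p hp)])
        calc F.x b ^ 2 - F.x p ^ 2 = (F.x b + F.x p) * (F.x b - F.x p) := by ring
          _ ≤ |(F.x b + F.x p) * (F.x b - F.x p)| := le_abs_self _
          _ = |F.x b + F.x p| * |F.x p - F.x b| := by rw [abs_mul, abs_sub_comm (F.x p)]
          _ ≤ 2 * s * 1 := mul_le_mul h5 h1 (abs_nonneg _) (by linarith)
          _ = 2 * s := mul_one _
      have h6 := hmin p hp
      have h7 := hy b (hmem b hb)
      have h8 : F.y p - F.y b ≤ (W + 2 * s) / (2 * ρ) := by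
        rw [le_div_iff₀ (by positivity)]
        nlinarith
      linarith
    · have : (J + 2) * ((1 + 2) * ((W + 2 * s) / (2 * ρ) + 2)) ≤
          (3 * J) * ((1 + 2) * ((W + 2 * s) / (2 * ρ) + 2)) := by
        gcongr; linarith
      nlinarith
  · have h1 : (S.image fun p => ⌊F.x p⌋) ⊆ Finset.Icc ⌊-s⌋ ⌊-s + 2 * s⌋ := by
      intro z hz
      obtain ⟨p, hp, rfl⟩ := Finset.mem_image.1 hz
      obtain ⟨h2, h3⟩ := abs_le.1 (hx p hp)
      exact Finset.mem_Icc.2 ⟨Int.floor_mono h2, Int.floor_mono (by linarith)⟩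
    have h2 : ((S.image fun p => ⌊F.x p⌋).card : ℝ) ≤ 2 * s + 2 :=
      (Nat.cast_le.2 (Finset.card_le_card h1)).trans (card_floor_le (by linarith))
    calc _ ≤ 243 * J * ((W + 2 * s) / (2 * ρ) + 2) * (2 * s + 2) := by gcongr
      _ = _ := by ring

/-- Every point lies in the sector `|x| ≤ y` after a quarter turn. -/
theorem card_le_four_mul (F : Frame) (S : Finset Mom) (B : ℝ)
    (h : ∀ F' : Frame, F'.t = F.t → F'.perpSq = F.perpSq → ∀ S' ⊆ S,
      (∀ p ∈ S', |F'.x p| ≤ F'.y p) → (S'.card : ℝ) ≤ B) : (S.card : ℝ) ≤ 4 * B := by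
  have hrot : ∀ a b : ℝ, ∀ hab : a ^ 2 + b ^ 2 = 1,
      ((S.filter fun p => |(F.rot a b hab).x p| ≤ (F.rot a b hab).y p).card : ℝ) ≤ B :=
    fun a b hab => h (F.rot a b hab) rfl (funext fun p => F.perpSq_rot a b hab p) _
      (Finset.filter_subset _ _) fun p hp => (Finset.mem_filter.1 hp).2
  have h1 := hrot 1 0 (by norm_num)
  have h2 := hrot (-1) 0 (by norm_num)
  have h3 := hrot 0 1 (by norm_num)
  have h4 := hrot 0 (-1) (by norm_num)
  simp only [rot, one_mul, zero_mul, add_zero, sub_zero, zero_add, zero_sub, neg_mul, neg_neg,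
    abs_neg] at h1 h2 h3 h4
  have hsub : S ⊆ (((S.filter fun p => |F.x p| ≤ F.y p) ∪
      (S.filter fun p => |F.x p| ≤ -F.y p)) ∪ (S.filter fun p => |F.y p| ≤ -F.x p)) ∪
      (S.filter fun p => |F.y p| ≤ F.x p) := by
    intro p hp
    simp only [Finset.mem_union, Finset.mem_filter, hp, true_and]
    rcases le_total (F.x p) 0 with hx | hx <;> rcases le_total (F.y p) 0 with hy | hy <;>
      simp only [abs_of_nonneg, abs_of_nonpos, hx, hy] <;>
      rcases le_total |F.x p| |F.y p| with hxy | hxy <;>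
      simp only [abs_of_nonneg, abs_of_nonpos, hx, hy] at hxy <;> simp [hxy]
  have h5 := Finset.card_le_card hsub
  have h6 := (h5.trans (Finset.card_union_le _ _)).trans (Nat.add_le_add_right
    ((Finset.card_union_le _ _).trans (Nat.add_le_add_right (Finset.card_union_le _ _) _)) _)
  have h7 : (S.card : ℝ) ≤ _ := Nat.cast_le.2 h6
  push_cast at h7
  linarith

/-- An annulus `X ≤ q² ≤ X + W` contains at most as many points as its area plus its
perimeter. -/
theorem exists_card_annulus_le : ∃ C : ℝ, 0 < C ∧ ∀ (F : Frame) (S : Finset Mom) (t₀ J X W : ℝ),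
    1 ≤ J → 0 ≤ X → 0 ≤ W → (∀ p ∈ S, t₀ ≤ F.t p ∧ F.t p ≤ t₀ + J) →
    (∀ p ∈ S, X ≤ F.perpSq p ∧ F.perpSq p ≤ X + W) →
    (S.card : ℝ) ≤ C * J * (W + Real.sqrt X + 1) := by
  refine ⟨20000, by norm_num, fun F S t₀ J X W hJ hX hW ht hq => ?_⟩
  have hX0 := Real.sqrt_nonneg X
  have hX2 := Real.sq_sqrt hX
  rcases le_or_gt X (W + 1) with hXW | hXW
  · set r := Real.sqrt (X + W) with hr
    have hr0 : 0 ≤ r := Real.sqrt_nonneg _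
    have hr2 : r ^ 2 = X + W := Real.sq_sqrt (by linarith)
    have hxr : ∀ p ∈ S, |F.x p| ≤ r := fun p hp => by
      rw [← Real.sqrt_sq_eq_abs]
      refine Real.sqrt_le_sqrt (le_trans ?_ (hq p hp).2)
      simp only [perpSq]; nlinarith [sq_nonneg (F.y p)]
    have hyr : ∀ p ∈ S, |F.y p| ≤ r := fun p hp => by
      rw [← Real.sqrt_sq_eq_abs]
      refine Real.sqrt_le_sqrt (le_trans ?_ (hq p hp).2)
      simp only [perpSq]; nlinarith [sq_nonneg (F.x p)]
    have h1 := F.card_box_le S (t₀ := t₀) (J := J) (x₀ := -r) (s := 2 * r) (y₀ := -r)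
      (r := 2 * r) (by linarith) (by linarith) (by linarith) ht
      (fun p hp => by have := abs_le.1 (hxr p hp); constructor <;> linarith)
      (fun p hp => by have := abs_le.1 (hyr p hp); constructor <;> linarith)
    have h2 : (2 * r + 2) * (2 * r + 2) ≤ 16 * (W + 1) := by nlinarith [sq_nonneg (r - 1)]
    calc (S.card : ℝ) ≤ 27 * ((J + 2) * ((2 * r + 2) * (2 * r + 2))) := h1
      _ ≤ 27 * ((3 * J) * (16 * (W + 1))) := by gcongr; linarith
      _ ≤ 20000 * J * (W + Real.sqrt X + 1) := by
        have : 0 ≤ J * Real.sqrt X := by positivity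
        nlinarith [mul_nonneg (by linarith : (0 : ℝ) ≤ J) hW]
  · have hX1 : 1 ≤ Real.sqrt X := by rw [Real.one_le_sqrt]; linarith
    set ρ := Real.sqrt X with hρ
    have h1 := F.card_le_four_mul S (243 * J * (4 * (4 * W + 4 * ρ))) ?_
    · refine h1.trans ?_
      nlinarith [mul_nonneg (by linarith : (0 : ℝ) ≤ J) hW, mul_nonneg (by linarith : (0 : ℝ) ≤ J)
        hX0]
    intro F' hFt hFq S' hS' hsec
    have hq' : ∀ p ∈ S', X ≤ F'.perpSq p ∧ F'.perpSq p ≤ X + W := fun p hp => by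
      rw [hFq]; exact hq p (hS' hp)
    have hxy : ∀ p ∈ S', F'.x p ^ 2 ≤ F'.y p ^ 2 ∧ 0 ≤ F'.y p := fun p hp =>
      ⟨sq_le_sq' (by linarith [neg_abs_le (F'.x p), hsec p hp])
        ((le_abs_self _).trans (hsec p hp)), (abs_nonneg _).trans (hsec p hp)⟩
    have h2 := F'.card_strip_le S' (t₀ := t₀) (J := J) (s := ρ) (ρ := ρ / 2) (X := X) (W := W) hJ
      hX0 (by linarith) hW (fun p hp => by rw [hFt]; exact ht p (hS' hp)) (fun p hp => ?_)
      (fun p hp => ?_) hq'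
    · refine h2.trans ?_
      rw [mul_div_cancel₀ ρ (two_ne_zero)]
      refine mul_le_mul_of_nonneg_left ?_ (by linarith)
      have h3 : (W + 2 * ρ) / ρ * ρ = W + 2 * ρ := div_mul_cancel₀ _ (by linarith)
      have h4 : 0 ≤ (W + 2 * ρ) / ρ := by positivity
      calc (2 * ρ + 2) * ((W + 2 * ρ) / ρ + 2) ≤ (4 * ρ) * ((W + 2 * ρ) / ρ + 2) := by
            gcongr; linarith
        _ = 4 * ((W + 2 * ρ) / ρ * ρ + 2 * ρ) := by ring
        _ = 4 * (W + 4 * ρ) := by rw [h3]; ring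
        _ ≤ _ := by linarith
    · have := (hq' p hp).2
      simp only [perpSq] at this
      refine abs_le_of_sq_le_sq ?_ hX0
      linarith [(hxy p hp).1]
    · have := (hq' p hp).1
      simp only [perpSq] at this
      refine le_of_sq_le_sq ?_ (hxy p hp).2
      nlinarith [(hxy p hp).1]

/-- Points of a thin annulus in a strip orthogonal to a vector of length `r`. -/
theorem exists_card_chord_le : ∃ C : ℝ, 0 < C ∧
    ∀ (F : Frame) (S : Finset Mom) (t₀ J X L r a b : ℝ), 1 ≤ J → 0 ≤ X → 1 ≤ L →
    20 * L ^ 2 ≤ Real.sqrt X → 1 ≤ r → r ≤ 4 * L → a ^ 2 + b ^ 2 = r ^ 2 →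
    (∀ p ∈ S, t₀ ≤ F.t p ∧ F.t p ≤ t₀ + J) →
    (∀ p ∈ S, X ≤ F.perpSq p ∧ F.perpSq p ≤ X + L ^ 2) →
    (∀ p ∈ S, |a * F.x p + b * F.y p| ≤ 6 * L ^ 2) →
    (S.card : ℝ) ≤ C * J * (L ^ 2 / r) := by
  refine ⟨40000, by norm_num, fun F S t₀ J X L r a b hJ hX hL hLX hr hrL hab ht hq hs => ?_⟩
  have hr0 : 0 < r := by linarith
  have hX2 := Real.sq_sqrt hX
  set ρ := Real.sqrt X with hρ
  have hρ0 : 0 < ρ := by nlinarith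
  set s := 6 * L ^ 2 / r with hsdef
  have hs0 : 0 ≤ s := by positivity
  have hsL : s ≤ 6 * L ^ 2 := div_le_self (by positivity) hr
  have hsρ : s ≤ ρ / 2 := by linarith
  have hLr : 1 ≤ 4 * (L ^ 2 / r) := by
    rw [mul_div_assoc', one_le_div hr0]; nlinarith
  -- both sides of the annulus, after a rotation which makes the strip vertical
  have hside : ∀ a' b' : ℝ, ∀ hab' : a' ^ 2 + b' ^ 2 = 1,
      (∀ p ∈ S, |a' * F.x p + b' * F.y p| ≤ s) →
      ((S.filter fun p => 0 ≤ a' * F.y p - b' * F.x p).card : ℝ) ≤ 20000 * J * (L ^ 2 / r) := by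
    intro a' b' hab' hst
    set F' := F.rot a' b' hab' with hF'
    set S' := S.filter fun p => 0 ≤ a' * F.y p - b' * F.x p with hS'
    have hmem : ∀ p ∈ S', p ∈ S := fun p hp => (Finset.mem_filter.1 hp).1
    have hq' : ∀ p ∈ S', X ≤ F'.perpSq p ∧ F'.perpSq p ≤ X + L ^ 2 := fun p hp => by
      rw [hF', perpSq_rot]; exact hq p (hmem p hp)
    have h1 := F'.card_strip_le S' (t₀ := t₀) (J := J) (s := s) (ρ := ρ / 2) (X := X)
      (W := L ^ 2) hJ hs0 (by linarith) (by positivity) (fun p hp => ht p (hmem p hp))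
      (fun p hp => hst p (hmem p hp)) (fun p hp => ?_) hq'
    · refine h1.trans ?_
      rw [mul_div_cancel₀ ρ (two_ne_zero)]
      have h2 : (L ^ 2 + 2 * s) / ρ ≤ 2 := by
        rw [div_le_iff₀ hρ0]; linarith
      have h3 : 2 * s + 2 ≤ 20 * (L ^ 2 / r) := by
        rw [hsdef, mul_div_assoc]; linarith
      calc 243 * J * ((2 * s + 2) * ((L ^ 2 + 2 * s) / ρ + 2))
          ≤ 243 * J * ((20 * (L ^ 2 / r)) * (2 + 2)) := by gcongr
        _ ≤ _ := by
          have : 0 ≤ J * (L ^ 2 / r) := by positivity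
          nlinarith
    · have h2 := (hq' p hp).1
      simp only [perpSq] at h2
      have h3 : F'.x p ^ 2 ≤ s ^ 2 := sq_le_sq' (abs_le.1 (hst p (hmem p hp))).1
        (abs_le.1 (hst p (hmem p hp))).2
      refine le_of_sq_le_sq ?_ (Finset.mem_filter.1 hp).2
      nlinarith
  have hab' : (a / r) ^ 2 + (b / r) ^ 2 = 1 := by
    rw [div_pow, div_pow, ← add_div, hab, div_self (by positivity)]
  have hst : ∀ p ∈ S, |a / r * F.x p + b / r * F.y p| ≤ s := by
    intro p hp
    rw [show a / r * F.x p + b / r * F.y p = (a * F.x p + b * F.y p) / r by ring, abs_div,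
      abs_of_pos hr0, hsdef]
    exact div_le_div_of_nonneg_right (hs p hp) hr0.le
  have h1 := hside (a / r) (b / r) hab' hst
  have h2 := hside (-(a / r)) (-(b / r)) (by rw [neg_sq, neg_sq, hab']) fun p hp => by
    rw [show -(a / r) * F.x p + -(b / r) * F.y p = -(a / r * F.x p + b / r * F.y p) by ring,
      abs_neg]
    exact hst p hp
  have hsub : S ⊆ (S.filter fun p => 0 ≤ a / r * F.y p - b / r * F.x p) ∪
      (S.filter fun p => 0 ≤ -(a / r) * F.y p - -(b / r) * F.x p) := by
    intro p hp
    simp only [Finset.mem_union, Finset.mem_filter, hp, true_and]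
    rcases le_total 0 (a / r * F.y p - b / r * F.x p) with h | h
    · exact Or.inl h
    · right; linarith
  have h3 : (S.card : ℝ) ≤ _ :=
    Nat.cast_le.2 ((Finset.card_le_card hsub).trans (Finset.card_union_le _ _))
  push_cast at h3
  linarith

/-- The length of the transversal component. -/
def perp (F : Frame) (p : Mom) : ℝ := Real.sqrt (F.perpSq p)

/-- Pairs of nearby points of a thin annulus. If the difference `u` of a pair has transversal
component `v`, both points being in the annulus confines them to the strip `|q·v| ≪ L²`. -/
theorem exists_card_pairs_le : ∃ C : ℝ, 0 < C ∧
    ∀ (F : Frame) (S : Finset Mom) (P : Finset (Mom × Mom)) (t₀ J X L : ℝ), 1 ≤ J → 0 ≤ X →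
    1 ≤ L → 20 * L ^ 2 ≤ Real.sqrt X → (∀ p ∈ S, t₀ ≤ F.t p ∧ F.t p ≤ t₀ + J) →
    (∀ p ∈ S, X ≤ F.perpSq p ∧ F.perpSq p ≤ X + L ^ 2) →
    (∀ z ∈ P, z.1 ∈ S ∧ z.2 ∈ S ∧ F.perpSq (z.2 - z.1) ≤ 10 * L ^ 2) →
    (P.card : ℝ) ≤ C * (J * S.card + J ^ 2 * L ^ 3) := by
  obtain ⟨C₁, hC₁, hann⟩ := exists_card_annulus_le
  obtain ⟨C₂, hC₂, hchord⟩ := exists_card_chord_le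
  refine ⟨1296 + 4 * (C₂ * (C₁ * 2 * 5)), by positivity,
    fun F S P t₀ J X L hJ hX hL hLX ht hq hP => ?_⟩
  have hJ0 : 0 < J := by linarith
  have hL0 : 0 < L := by linarith
  have hperp2 : ∀ u, F.perp u ^ 2 = F.perpSq u := fun u => Real.sq_sqrt (F.perpSq_nonneg u)
  have hperp0 : ∀ u, 0 ≤ F.perp u := fun u => Real.sqrt_nonneg _
  set m := ⌊4 * L⌋₊ with hm
  have hmL : (m : ℝ) ≤ 4 * L := Nat.floor_le (by linarith)
  have hle : ∀ z ∈ P, F.perp (z.2 - z.1) ≤ 4 * L := fun z hz => by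
    refine le_of_sq_le_sq ?_ (by linarith)
    rw [hperp2]
    nlinarith [(hP z hz).2.2]
  have hmaps : ∀ z ∈ P, ⌊F.perp (z.2 - z.1)⌋₊ ∈ Finset.range (m + 1) := fun z hz =>
    Finset.mem_range.2 (Nat.lt_succ_of_le (Nat.floor_mono (hle z hz)))
  rw [Finset.card_eq_sum_card_fiberwise hmaps]
  push_cast
  rw [Finset.sum_range_succ']
  -- differences with a transversal component shorter than one
  have hzero : ((P.filter fun z => ⌊F.perp (z.2 - z.1)⌋₊ = 0).card : ℝ) ≤ 1296 * J * S.card := by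
    refine (card_le_mul_card_image_of_fiber _ Prod.fst (1296 * J) fun z₀ hz₀ => ?_).trans ?_
    · set P' := (P.filter fun z => ⌊F.perp (z.2 - z.1)⌋₊ = 0).filter fun z => z.1 = z₀.1 with hP'
      have hmem : ∀ z ∈ P', z ∈ P ∧ F.perp (z.2 - z.1) < 1 ∧ z.1 = z₀.1 := by
        intro z hz
        obtain ⟨h1, h2⟩ := Finset.mem_filter.1 hz
        obtain ⟨h3, h4⟩ := Finset.mem_filter.1 h1
        exact ⟨h3, Nat.floor_eq_zero.1 h4, h2⟩
      have hinj : Set.InjOn Prod.snd (P' : Set (Mom × Mom)) := by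
        intro z hz z' hz' h
        exact Prod.ext ((hmem z hz).2.2.trans (hmem z' hz').2.2.symm) h
      rw [← Finset.card_image_of_injOn hinj]
      have hxy : ∀ z ∈ P', |F.x z.2 - F.x z₀.1| ≤ 1 ∧ |F.y z.2 - F.y z₀.1| ≤ 1 := by
        intro z hz
        obtain ⟨-, h1, h2⟩ := hmem z hz
        have h3 : F.perpSq (z.2 - z.1) ≤ 1 := by
          rw [← hperp2]; nlinarith [hperp0 (z.2 - z.1)]
        rw [h2] at h3
        simp only [perpSq, F.x_sub, F.y_sub] at h3
        exact ⟨abs_le_of_sq_le_sq (by nlinarith [sq_nonneg (F.y z.2 - F.y z₀.1)]) zero_le_one,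
          abs_le_of_sq_le_sq (by nlinarith [sq_nonneg (F.x z.2 - F.x z₀.1)]) zero_le_one⟩
      have h5 := F.card_box_le (P'.image Prod.snd) (t₀ := t₀) (J := J) (x₀ := F.x z₀.1 - 1)
        (s := 2) (y₀ := F.y z₀.1 - 1) (r := 2) hJ0.le (by norm_num) (by norm_num) ?_ ?_ ?_
      · refine h5.trans ?_
        nlinarith
      · intro p hp
        obtain ⟨z, hz, rfl⟩ := Finset.mem_image.1 hp
        exact ht _ (hP z (hmem z hz).1).2.1
      · intro p hp
        obtain ⟨z, hz, rfl⟩ := Finset.mem_image.1 hp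
        have := abs_le.1 (hxy z hz).1
        constructor <;> linarith
      · intro p hp
        obtain ⟨z, hz, rfl⟩ := Finset.mem_image.1 hp
        have := abs_le.1 (hxy z hz).2
        constructor <;> linarith
    · refine mul_le_mul_of_nonneg_left ?_ (by positivity)
      refine Nat.cast_le.2 (Finset.card_le_card fun p hp => ?_)
      obtain ⟨z, hz, rfl⟩ := Finset.mem_image.1 hp
      exact (hP z (Finset.mem_filter.1 hz).1).1
  -- differences with a transversal component of length in `[j, j + 1)`, `j ≥ 1`
  have hpos : ∀ i ∈ Finset.range m,
      ((P.filter fun z => ⌊F.perp (z.2 - z.1)⌋₊ = i + 1).card : ℝ) ≤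
        C₂ * (C₁ * 2 * 5) * J ^ 2 * L ^ 2 := by
    intro i _
    set j : ℝ := (i : ℝ) + 1 with hj
    have hj1 : 1 ≤ j := by rw [hj]; linarith [Nat.cast_nonneg (α := ℝ) i]
    set P' := P.filter fun z => ⌊F.perp (z.2 - z.1)⌋₊ = i + 1 with hP'
    have hmem : ∀ z ∈ P', z ∈ P ∧ j ≤ F.perp (z.2 - z.1) ∧ F.perp (z.2 - z.1) ≤ j + 1 := by
      intro z hz
      obtain ⟨h1, h2⟩ := Finset.mem_filter.1 hz
      rw [Nat.floor_eq_iff (hperp0 _)] at h2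
      push_cast at h2
      exact ⟨h1, h2.1, h2.2.le⟩
    refine (card_le_mul_card_image_of_fiber P' (fun z => z.2 - z.1) (C₂ * J * (L ^ 2 / j))
      fun z₀ hz₀ => ?_).trans ?_
    · set u := z₀.2 - z₀.1 with hu
      obtain ⟨hz₀P, hjr, -⟩ := hmem z₀ hz₀
      have hmem2 : ∀ z ∈ P'.filter fun z => z.2 - z.1 = u, z ∈ P ∧ z.2 - z.1 = u := fun z hz =>
        ⟨(hmem z (Finset.mem_filter.1 hz).1).1, (Finset.mem_filter.1 hz).2⟩
      have hinj : Set.InjOn Prod.fst ((P'.filter fun z => z.2 - z.1 = u) : Set (Mom × Mom)) := by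
        intro z hz z' hz' h
        have h1 := (hmem2 z hz).2.trans (hmem2 z' hz').2.symm
        rw [h] at h1
        exact Prod.ext h (sub_left_injective h1)
      rw [← Finset.card_image_of_injOn hinj]
      have h1 := hchord F ((P'.filter fun z => z.2 - z.1 = u).image Prod.fst) t₀ J X L (F.perp u)
        (F.x u) (F.y u) hJ hX hL hLX (hj1.trans hjr) (hle z₀ hz₀P) (hperp2 u).symm ?_ ?_ ?_
      · exact h1.trans (by gcongr)
      · intro p hp
        obtain ⟨z, hz, rfl⟩ := Finset.mem_image.1 hp
        exact ht _ (hP z (hmem2 z hz).1).1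
      · intro p hp
        obtain ⟨z, hz, rfl⟩ := Finset.mem_image.1 hp
        exact hq _ (hP z (hmem2 z hz).1).1
      · intro p hp
        obtain ⟨z, hz, rfl⟩ := Finset.mem_image.1 hp
        obtain ⟨hzP, hzu⟩ := hmem2 z hz
        obtain ⟨hz1, hz2, h10⟩ := hP z hzP
        have e1 := hq _ hz1
        have e2 := hq _ hz2
        have hx : F.x u = F.x z.2 - F.x z.1 := by rw [← hzu, F.x_sub]
        have hy : F.y u = F.y z.2 - F.y z.1 := by rw [← hzu, F.y_sub]
        rw [hzu] at h10
        simp only [perpSq] at e1 e2 h10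
        -- `2 q·v = |q + v|² - |q|² - |v|²`
        have key : 2 * (F.x u * F.x z.1 + F.y u * F.y z.1) =
            (F.x z.2 ^ 2 + F.y z.2 ^ 2) - (F.x z.1 ^ 2 + F.y z.1 ^ 2) -
              (F.x u ^ 2 + F.y u ^ 2) := by
          rw [hx, hy]; ring
        have := sq_nonneg (F.x u)
        have := sq_nonneg (F.y u)
        rw [abs_le]
        constructor <;> nlinarith
    · have hcard : ((P'.image fun z => z.2 - z.1).card : ℝ) ≤
          C₁ * (2 * J) * ((2 * j + 1) + Real.sqrt (j ^ 2) + 1) := by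
        refine hann F _ (-J) (2 * J) (j ^ 2) (2 * j + 1) (by linarith) (by positivity)
          (by linarith) ?_ ?_
        · intro p hp
          obtain ⟨z, hz, rfl⟩ := Finset.mem_image.1 hp
          obtain ⟨hz1, hz2, -⟩ := hP z (hmem z hz).1
          rw [F.t_sub]
          have := ht _ hz1
          have := ht _ hz2
          constructor <;> linarith
        · intro p hp
          obtain ⟨z, hz, rfl⟩ := Finset.mem_image.1 hp
          obtain ⟨-, h1, h2⟩ := hmem z hz
          rw [← hperp2]
          constructor <;> nlinarith
      rw [Real.sqrt_sq (by linarith)] at hcard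
      calc _ ≤ C₂ * J * (L ^ 2 / j) * (C₁ * (2 * J) * (5 * j)) := by
            refine mul_le_mul_of_nonneg_left (hcard.trans ?_) (by positivity)
            gcongr; linarith
        _ = C₂ * (C₁ * 2 * 5) * J ^ 2 * L ^ 2 * (j / j) := by ring
        _ = _ := by rw [div_self (by linarith), mul_one]
  have hsum := Finset.sum_le_sum hpos
  rw [Finset.sum_const, Finset.card_range, nsmul_eq_mul] at hsum
  have h1 : (m : ℝ) * (C₂ * (C₁ * 2 * 5) * J ^ 2 * L ^ 2) ≤
      4 * L * (C₂ * (C₁ * 2 * 5) * J ^ 2 * L ^ 2) := by gcongr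
  have h2 : 0 ≤ J * (S.card : ℝ) := by positivity
  have h3 : 0 ≤ J ^ 2 * L ^ 3 := by positivity
  have h4 : 0 ≤ C₂ * (C₁ * 2 * 5) := by positivity
  nlinarith [mul_nonneg h4 h2, mul_nonneg h4 h3]

/-- Second moment bound for the number of points in a thin annulus of radius `√X` and area `L²`.
The annulus is cut into `√X / L` cells of diameter of order `L`; by Cauchy–Schwarz the square of
the number of points is at most the number of cells times the number of pairs in a common cell. -/
theorem exists_card_thin_annulus_le : ∃ C : ℝ, 0 < C ∧
    ∀ (F : Frame) (S : Finset Mom) (t₀ J X L : ℝ), 1 ≤ J → 0 ≤ X →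
    1 ≤ L → 20 * L ^ 2 ≤ Real.sqrt X → (∀ p ∈ S, t₀ ≤ F.t p ∧ F.t p ≤ t₀ + J) →
    (∀ p ∈ S, X ≤ F.perpSq p ∧ F.perpSq p ≤ X + L ^ 2) →
    (S.card : ℝ) ≤ C * (Real.sqrt X * J / L + Real.sqrt (Real.sqrt X) * L * J) := by
  obtain ⟨C, hC, hpairs⟩ := exists_card_pairs_le
  refine ⟨4 * (3 * C + Real.sqrt (3 * C)), by positivity,
    fun F S t₀ J X L hJ hX hL hLX ht hq => ?_⟩
  have hJ0 : 0 < J := by linarith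
  have hL0 : 0 < L := by linarith
  have hX2 := Real.sq_sqrt hX
  set ρ := Real.sqrt X with hρ
  have hρL : 20 * L ≤ ρ := by nlinarith
  have hρ0 : 0 < ρ := by linarith
  rw [mul_assoc]
  refine F.card_le_four_mul S _ fun F' hFt hFq S' hS' hsec => ?_
  have ht' : ∀ p ∈ S', t₀ ≤ F'.t p ∧ F'.t p ≤ t₀ + J := fun p hp => by
    rw [hFt]; exact ht p (hS' hp)
  have hq' : ∀ p ∈ S', X ≤ F'.perpSq p ∧ F'.perpSq p ≤ X + L ^ 2 := fun p hp => by
    rw [hFq]; exact hq p (hS' hp)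
  have hxy : ∀ p ∈ S', F'.x p ^ 2 ≤ F'.y p ^ 2 ∧ 0 ≤ F'.y p := fun p hp =>
    ⟨sq_le_sq' (by linarith [neg_abs_le (F'.x p), hsec p hp])
      ((le_abs_self _).trans (hsec p hp)), (abs_nonneg _).trans (hsec p hp)⟩
  have hx : ∀ p ∈ S', |F'.x p| ≤ ρ := fun p hp => by
    have := (hq' p hp).2
    simp only [perpSq] at this
    refine abs_le_of_sq_le_sq ?_ hρ0.le
    nlinarith [(hxy p hp).1]
  have hy : ∀ p ∈ S', ρ / 2 ≤ F'.y p := fun p hp => by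
    have := (hq' p hp).1
    simp only [perpSq] at this
    refine le_of_sq_le_sq ?_ (hxy p hp).2
    nlinarith [(hxy p hp).1]
  let cell : Mom → ℤ := fun p => ⌊F'.x p / L⌋
  set P := (S' ×ˢ S').filter fun z => cell z.1 = cell z.2 with hPdef
  have hPcard := hpairs F' S' P t₀ J X L hJ hX hL hLX ht' hq' ?_
  · have hcells : ((S'.image cell).card : ℝ) ≤ 3 * ρ / L := by
      have h1 : S'.image cell ⊆ Finset.Icc ⌊-(ρ / L)⌋ ⌊-(ρ / L) + 2 * (ρ / L)⌋ := by
        intro c hc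
        obtain ⟨p, hp, rfl⟩ := Finset.mem_image.1 hc
        obtain ⟨h2, h3⟩ := abs_le.1 (hx p hp)
        refine Finset.mem_Icc.2 ⟨Int.floor_mono ?_, Int.floor_mono ?_⟩
        · rw [← neg_div]; gcongr
        · rw [show -(ρ / L) + 2 * (ρ / L) = ρ / L by ring]; gcongr
      have h2 : ((S'.image cell).card : ℝ) ≤ 2 * (ρ / L) + 2 :=
        (Nat.cast_le.2 (Finset.card_le_card h1)).trans (card_floor_le (by positivity))
      have h3 : 20 ≤ ρ / L := by rw [le_div_iff₀ hL0]; exact hρL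
      rw [mul_div_assoc]
      linarith
    have hsqN : S'.card ^ 2 ≤ (S'.image cell).card * P.card := by
      have h1 : S'.card = ∑ c ∈ S'.image cell, (S'.filter fun p => cell p = c).card :=
        Finset.card_eq_sum_card_image cell S'
      have h2 : P.card = ∑ c ∈ S'.image cell, (S'.filter fun p => cell p = c).card ^ 2 := by
        rw [Finset.card_eq_sum_card_fiberwise (f := fun z : Mom × Mom => cell z.1)
          (t := S'.image cell)]
        · refine Finset.sum_congr rfl fun c _ => ?_
          rw [pow_two, ← Finset.card_product]
          congr 1
          ext z
          simp only [hPdef, Finset.mem_filter, Finset.mem_product]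
          constructor
          · rintro ⟨⟨⟨h3, h4⟩, h5⟩, h6⟩
            exact ⟨⟨h3, h6⟩, h4, h5.symm.trans h6⟩
          · rintro ⟨⟨h3, h6⟩, h4, h7⟩
            exact ⟨⟨⟨h3, h4⟩, h6.trans h7.symm⟩, h6⟩
        · intro z hz
          have := (Finset.mem_product.1 (Finset.mem_filter.1 hz).1).1
          exact Finset.mem_image_of_mem _ this
      rw [h1, h2]
      exact sq_sum_le_card_mul_sum_sq
    have hsq : (S'.card : ℝ) ^ 2 ≤ (3 * ρ / L) * (C * (J * S'.card + J ^ 2 * L ^ 3)) := by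
      calc (S'.card : ℝ) ^ 2 ≤ ((S'.image cell).card : ℝ) * P.card := by exact_mod_cast hsqN
        _ ≤ _ := by gcongr
    -- `A² ≤ α A + β²` implies `A ≤ α + β`
    set α := 3 * C * (ρ * J / L) with hα
    set β := Real.sqrt (3 * C) * (Real.sqrt ρ * L * J) with hβ
    have hα0 : 0 ≤ α := by positivity
    have hβ0 : 0 ≤ β := by positivity
    have hβ2 : β ^ 2 = 3 * C * ρ * L ^ 2 * J ^ 2 := by
      rw [hβ, mul_pow, mul_pow, mul_pow, Real.sq_sqrt (by positivity), Real.sq_sqrt hρ0.le]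
      ring
    have hsq2 : (S'.card : ℝ) ^ 2 ≤ α * S'.card + β ^ 2 := by
      refine hsq.trans_eq ?_
      rw [hβ2, hα]
      field_simp
    have hfin : (S'.card : ℝ) ≤ α + β := by
      by_contra hcon
      push Not at hcon
      nlinarith
    refine hfin.trans ?_
    have h1 : 0 ≤ ρ * J / L := by positivity
    have h2 : 0 ≤ Real.sqrt ρ * L * J := by positivity
    have h3 : 0 ≤ Real.sqrt (3 * C) := Real.sqrt_nonneg _
    rw [hα, hβ]
    nlinarith [mul_nonneg h3 h1, mul_nonneg hC.le h2]
  · intro z hz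
    obtain ⟨h1, h2⟩ := Finset.mem_filter.1 hz
    obtain ⟨hz1, hz2⟩ := Finset.mem_product.1 h1
    refine ⟨hz1, hz2, ?_⟩
    have hdx : |F'.x z.2 - F'.x z.1| ≤ L := by
      have h3 := abs_sub_le_one_of_floor_eq h2.symm
      rwa [← sub_div, abs_div, abs_of_pos hL0, div_le_one hL0] at h3
    have e1 := hq' _ hz1
    have e2 := hq' _ hz2
    simp only [perpSq, F'.x_sub, F'.y_sub] at e1 e2 ⊢
    have hxx : |F'.x z.2 ^ 2 - F'.x z.1 ^ 2| ≤ 2 * ρ * L := by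
      rw [show F'.x z.2 ^ 2 - F'.x z.1 ^ 2 =
        (F'.x z.2 + F'.x z.1) * (F'.x z.2 - F'.x z.1) by ring, abs_mul]
      refine mul_le_mul ((abs_add_le _ _).trans ?_) hdx (abs_nonneg _) (by positivity)
      linarith [hx _ hz1, hx _ hz2]
    have hdy : |F'.y z.2 - F'.y z.1| ≤ 3 * L := by
      have h5 : |F'.y z.2 - F'.y z.1| * ρ ≤ 3 * L * ρ := by
        calc |F'.y z.2 - F'.y z.1| * ρ
            ≤ |F'.y z.2 - F'.y z.1| * |F'.y z.2 + F'.y z.1| := by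
              gcongr
              exact le_trans (by linarith [hy _ hz1, hy _ hz2]) (le_abs_self _)
          _ = |F'.y z.2 ^ 2 - F'.y z.1 ^ 2| := by rw [← abs_mul]; congr 1; ring
          _ ≤ L ^ 2 + 2 * ρ * L := by
            obtain ⟨h6, h7⟩ := abs_le.1 hxx
            rw [abs_le]
            constructor <;> linarith
          _ ≤ _ := by nlinarith
      exact le_of_mul_le_mul_right h5 hρ0
    have h8 := sq_le_sq' (abs_le.1 hdx).1 (abs_le.1 hdx).2
    have h9 := sq_le_sq' (abs_le.1 hdy).1 (abs_le.1 hdy).2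
    nlinarith

end Frame

/-! ### Counting pairs with bounded gap -/

theorem one_le_normSq {k : Mom} (hk : k ≠ 0) : 1 ≤ normSq k := by
  rw [normSq_eq_dotProduct]
  exact_mod_cast dotProduct_self_pos hk

/-- A frame of `ℝ³` whose axis is `k`. -/
theorem Frame.exists_axis {k : Mom} (hk : k ≠ 0) : ∃ F : Frame,
    (∀ p, 2 * Real.sqrt (normSq k) * F.t p - normSq k = gap k p) ∧
    ∀ p (n : ℤ), F.t (p - n • k) = F.t p - n * Real.sqrt (normSq k) ∧
      F.x (p - n • k) = F.x p ∧ F.y (p - n • k) = F.y p := by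
  obtain ⟨w, w', hw, -, hid⟩ := exists_orthogonal_frame hk
  have hk0 := dotProduct_self_pos hk
  have hkw : k ⬝ᵥ w = 0 ∧ k ⬝ᵥ w' = 0 := by
    have h := hid k
    have h1 : (k ⬝ᵥ k) * (k ⬝ᵥ w) ^ 2 + (k ⬝ᵥ w') ^ 2 = 0 := by linear_combination -h
    have h2 : 0 ≤ (k ⬝ᵥ k) * (k ⬝ᵥ w) ^ 2 := by positivity
    have h3 := sq_nonneg (k ⬝ᵥ w')
    have h4 : (k ⬝ᵥ k) * (k ⬝ᵥ w) ^ 2 = 0 := by omega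
    have h5 : (k ⬝ᵥ w') ^ 2 = 0 := by omega
    refine ⟨?_, pow_eq_zero_iff two_ne_zero |>.1 h5⟩
    rcases mul_eq_zero.1 h4 with h6 | h6
    · omega
    · exact pow_eq_zero_iff two_ne_zero |>.1 h6
  have hkR : 0 < normSq k := by linarith [one_le_normSq hk]
  have hwR : (0 : ℝ) < ((w ⬝ᵥ w : ℤ) : ℝ) := by exact_mod_cast hw
  set K := Real.sqrt (normSq k) with hK
  set ω := Real.sqrt ((w ⬝ᵥ w : ℤ) : ℝ) with hω
  have hK0 : 0 < K := Real.sqrt_pos.2 hkR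
  have hω0 : 0 < ω := Real.sqrt_pos.2 hwR
  have hK2 : K ^ 2 = normSq k := Real.sq_sqrt hkR.le
  have hω2 : ω ^ 2 = ((w ⬝ᵥ w : ℤ) : ℝ) := Real.sq_sqrt hwR.le
  refine ⟨⟨fun p => ((p ⬝ᵥ k : ℤ) : ℝ) / K, fun p => ((p ⬝ᵥ w : ℤ) : ℝ) / ω,
    fun p => ((p ⬝ᵥ w' : ℤ) : ℝ) / (K * ω), fun p q => ?_, fun p q => ?_, fun p q => ?_,
    fun p => ?_⟩, fun p => ?_, fun p n => ⟨?_, ?_, ?_⟩⟩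
  · rw [sub_dotProduct]; push_cast; rw [sub_div]
  · rw [sub_dotProduct]; push_cast; rw [sub_div]
  · rw [sub_dotProduct]; push_cast; rw [sub_div]
  · have h : (((k ⬝ᵥ k) * (w ⬝ᵥ w) * (p ⬝ᵥ p) : ℤ) : ℝ) = _ := congrArg (Int.cast : ℤ → ℝ) (hid p)
    push_cast at h
    rw [← hω2, ← normSq_eq_dotProduct, ← normSq_eq_dotProduct, ← hK2] at h
    field_simp
    linear_combination h
  · rw [gap_eq]
    push_cast
    rw [← normSq_eq_dotProduct]
    field_simp
  · simp only [sub_dotProduct, smul_dotProduct]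
    rw [smul_eq_mul]
    push_cast
    rw [← normSq_eq_dotProduct, ← hK2, sub_div]
    field_simp
  · simp only [sub_dotProduct, smul_dotProduct, hkw.1, smul_zero, sub_zero]
  · simp only [sub_dotProduct, smul_dotProduct, hkw.2, smul_zero, sub_zero]

/-- The axial and transversal coordinates of a pair with gap at most `M`. -/
theorem Frame.coord_bounds {R M : ℝ} (hR : 0 ≤ R) {k p : Mom} {F : Frame}
    (hk : 0 < Real.sqrt (normSq k))
    (hgap : ∀ p, 2 * Real.sqrt (normSq k) * F.t p - normSq k = gap k p)
    (hshift : ∀ p (n : ℤ), F.t (p - n • k) = F.t p - n * Real.sqrt (normSq k) ∧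
      F.x (p - n • k) = F.x p ∧ F.y (p - n • k) = F.y p)
    (hp : p ∈ pairSet R k) (hM : (gap k p : ℝ) ≤ M) :
    Real.sqrt (normSq k) / 2 ≤ F.t p ∧
      F.t p ≤ Real.sqrt (normSq k) / 2 + M / Real.sqrt (normSq k) / 2 ∧
      R ^ 2 < F.perpSq p + F.t p ^ 2 ∧
      F.perpSq p + (F.t p - Real.sqrt (normSq k)) ^ 2 ≤ R ^ 2 := by
  set K := Real.sqrt (normSq k) with hKdef
  have hK2 : K ^ 2 = normSq k := Real.sq_sqrt (Real.sqrt_pos.1 hk).le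
  have hHK : M / K * K = M := div_mul_cancel₀ _ hk.ne'
  obtain ⟨h3, h4⟩ := (mem_pairSet hR k p).1 hp
  have h5 : (1 : ℝ) ≤ gap k p := by exact_mod_cast one_le_gap hR hp
  have hg := hgap p
  rw [← hK2] at hg
  have hs := hshift p 1
  rw [one_smul] at hs
  push_cast at hs
  rw [F.normSq_eq] at h3 h4
  rw [hs.1, hs.2.1, hs.2.2, one_mul] at h3
  simp only [Frame.perpSq]
  refine ⟨?_, ?_, by linarith, by linarith⟩
  · nlinarith
  · have : K * F.t p ≤ K * (K / 2 + M / K / 2) := by nlinarith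
    exact le_of_mul_le_mul_left this hk

/-- Counting pairs whose axial range `M / |k|` is at least one period `|k|`. The points are
translated along `k` into one period; as each line in the direction `k` leaves the ball only once,
this loses no point. -/
theorem exists_card_gap_long_le : ∃ C : ℝ, 0 < C ∧ ∀ R : ℝ, 1 ≤ R →
    ∀ k : Mom, k ≠ 0 → ∀ M : ℝ, Real.sqrt R ≤ M → normSq k ≤ M →
    (((pairSet R k).filter fun p => (gap k p : ℝ) ≤ M).card : ℝ) ≤
      C * (Real.sqrt R * M + M ^ 2 / Real.sqrt (normSq k)) := by
  obtain ⟨C₁, hC₁, hann⟩ := Frame.exists_card_annulus_le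
  obtain ⟨C₂, hC₂, hthin⟩ := Frame.exists_card_thin_annulus_le
  refine ⟨81 * C₁ + 4 * C₂, by positivity, fun R hR k hk M hM hKM => ?_⟩
  obtain ⟨F, hgap, hshift⟩ := Frame.exists_axis hk
  have hk1 := one_le_normSq hk
  have hK2 : Real.sqrt (normSq k) ^ 2 = normSq k := Real.sq_sqrt (by linarith)
  have hK1 : 1 ≤ Real.sqrt (normSq k) := Real.one_le_sqrt.2 hk1
  have hR0 : 0 < R := by linarith
  have hfacts := fun (p : Mom) (hp : p ∈ (pairSet R k).filter fun p => (gap k p : ℝ) ≤ M) =>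
    Frame.coord_bounds hR0.le (by linarith) hgap hshift (Finset.mem_filter.1 hp).1
      (Finset.mem_filter.1 hp).2
  rw [← hK2] at hKM
  set T := (pairSet R k).filter fun p => (gap k p : ℝ) ≤ M with hT
  set K := Real.sqrt (normSq k) with hKdef
  have hK0 : 0 < K := by linarith
  have hs1 : 1 ≤ Real.sqrt R := Real.one_le_sqrt.2 hR
  have hs2 : Real.sqrt R ^ 2 = R := Real.sq_sqrt hR0.le
  set σ := Real.sqrt R with hσ
  have hM1 : 1 ≤ M := hs1.trans hM
  have hM0 : 0 < M := by linarith
  have hσ0 : 0 ≤ σ := by linarith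
  have hRM : R ≤ σ * M := by
    calc R = σ * σ := by rw [← pow_two, hs2]
      _ ≤ σ * M := by gcongr
  have hMs : M ≤ σ * M := le_mul_of_one_le_left hM0.le hs1
  have hM2 : M ^ 2 / K = M / K * M := by ring
  rw [hM2]
  clear hM2
  set H := M / K with hH
  have hH0 : 0 < H := by positivity
  have hHK : H * K = M := div_mul_cancel₀ _ hK0.ne'
  have hHM0 : 0 < H * M := by positivity
  have h4 : 0 ≤ σ * M := by positivity
  have hfin : C₂ * (4 * (σ * M)) ≤ (81 * C₁ + 4 * C₂) * (σ * M + H * M) := by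
    rw [show (81 * C₁ + 4 * C₂) * (σ * M + H * M) =
      C₂ * (4 * (σ * M)) + (81 * C₁ * (σ * M) + (81 * C₁ + 4 * C₂) * (H * M)) by ring]
    exact le_add_of_nonneg_right (by positivity)
  have hKH : K ≤ H := by rw [hH, le_div_iff₀ hK0, ← pow_two]; exact hKM
  have hH2 : M ≤ H ^ 2 := by
    rw [← hHK, pow_two]; gcongr
  let φ : Mom → Mom := fun p => p - ⌊F.t p / K⌋ • k
  -- if `q = p + n k` with `n ≥ 1`, then `q - k` is at least as far out as `p`, which is outside
  -- the ball
  have hinj : Set.InjOn φ T := by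
    have hlt : ∀ p ∈ T, ∀ q ∈ T, φ p = φ q → ¬⌊F.t p / K⌋ < ⌊F.t q / K⌋ := by
      intro p hp q hq hpq hlt
      obtain ⟨h1, -, h3, -⟩ := hfacts p hp
      obtain ⟨g1, -, -, g4⟩ := hfacts q hq
      obtain ⟨a1, a2, a3⟩ := hshift p ⌊F.t p / K⌋
      obtain ⟨b1, b2, b3⟩ := hshift q ⌊F.t q / K⌋
      have e1 : F.t p - ⌊F.t p / K⌋ * K = F.t q - ⌊F.t q / K⌋ * K := by
        rw [← a1, ← b1]; exact congrArg F.t hpq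
      have e2 : F.x p = F.x q := by rw [← a2, ← b2]; exact congrArg F.x hpq
      have e3 : F.y p = F.y q := by rw [← a3, ← b3]; exact congrArg F.y hpq
      simp only [Frame.perpSq, e2, e3] at h3 g4
      have e4 : (⌊F.t p / K⌋ : ℝ) + 1 ≤ ⌊F.t q / K⌋ := by exact_mod_cast hlt
      have e5 : F.t p ≤ F.t q - K := by
        linarith [mul_le_mul_of_nonneg_right e4 hK0.le]
      have e6 : 0 ≤ F.t p := by linarith
      linarith [pow_le_pow_left₀ e6 e5 2]
    intro p hp q hq hpq
    have h1 : ⌊F.t p / K⌋ = ⌊F.t q / K⌋ :=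
      le_antisymm (not_lt.1 (hlt q hq p hp hpq.symm)) (not_lt.1 (hlt p hp q hq hpq))
    simp only [φ, h1] at hpq
    exact sub_left_injective hpq
  rw [← Finset.card_image_of_injOn hinj]
  have ht : ∀ p ∈ T.image φ, 0 ≤ F.t p ∧ F.t p ≤ 0 + K := by
    intro q hq
    obtain ⟨p, hp, rfl⟩ := Finset.mem_image.1 hq
    simp only [φ]
    rw [(hshift p _).1]
    have h1 := Int.floor_le (F.t p / K)
    have h2 := (Int.lt_floor_add_one (F.t p / K)).le
    rw [le_div_iff₀ hK0] at h1
    rw [div_le_iff₀ hK0] at h2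
    constructor <;> linarith
  -- the projection lies in an annulus of area `H²`, as `0 ≤ t ≤ H` before the translation
  have hq : ∀ p ∈ T.image φ, R ^ 2 - H ^ 2 ≤ F.perpSq p ∧ F.perpSq p ≤ R ^ 2 := by
    intro q hq
    obtain ⟨p, hp, rfl⟩ := Finset.mem_image.1 hq
    obtain ⟨h1, h2, h3, h4⟩ := hfacts p hp
    have h5 : F.perpSq (φ p) = F.perpSq p := by
      simp only [φ, Frame.perpSq, (hshift p _).2.1, (hshift p _).2.2]
    rw [h5]
    constructor
    · linarith [pow_le_pow_left₀ (by linarith : 0 ≤ F.t p) (by linarith : F.t p ≤ H) 2]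
    · linarith [sq_nonneg (F.t p - K)]
  -- the annulus is wide if `H² ≥ R / 40`, and thin otherwise
  rcases le_or_gt (R / 40) (H ^ 2) with hHR | hHR
  · have h1 := hann F (T.image φ) 0 K (max 0 (R ^ 2 - H ^ 2)) (H ^ 2) hK1 (le_max_left _ _)
      (sq_nonneg _) ht fun p hp => ⟨max_le (F.perpSq_nonneg p) (hq p hp).1,
        (hq p hp).2.trans (by linarith [le_max_right 0 (R ^ 2 - H ^ 2)])⟩
    have h2 : Real.sqrt (max 0 (R ^ 2 - H ^ 2)) ≤ R := by
      rw [Real.sqrt_le_left hR0.le]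
      exact max_le (sq_nonneg _) (by linarith [sq_nonneg H])
    calc _ ≤ C₁ * K * (H ^ 2 + Real.sqrt (max 0 (R ^ 2 - H ^ 2)) + 1) := h1
      _ ≤ C₁ * K * (81 * H ^ 2) := by gcongr; linarith
      _ = 81 * C₁ * (H * M) := by rw [← hHK]; ring
      _ ≤ _ := by
        have : 0 ≤ σ * M := by positivity
        gcongr <;> linarith
  · have hX : R ^ 2 / 4 ≤ R ^ 2 - H ^ 2 := by
      linarith [le_self_pow₀ hR two_ne_zero]
    have hX2 : R / 2 ≤ Real.sqrt (R ^ 2 - H ^ 2) := by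
      apply Real.le_sqrt_of_sq_le; linarith
    have hX3 : Real.sqrt (R ^ 2 - H ^ 2) ≤ R := by
      rw [Real.sqrt_le_left hR0.le]; linarith [sq_nonneg H]
    have hH1 : 1 ≤ H := hK1.trans hKH
    have h1 := hthin F (T.image φ) 0 K (R ^ 2 - H ^ 2) H hK1 (by linarith [sq_nonneg R]) hH1
      (by linarith) ht fun p hp => ⟨(hq p hp).1, by linarith [(hq p hp).2]⟩
    have h2 : Real.sqrt (R ^ 2 - H ^ 2) * K / H ≤ σ * M := by
      rw [div_le_iff₀ hH0]
      calc _ ≤ R * H := by gcongr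
        _ ≤ _ := by gcongr
    have h3 : Real.sqrt (Real.sqrt (R ^ 2 - H ^ 2)) * H * K ≤ σ * M := by
      rw [mul_assoc, hHK]
      gcongr
      exact Real.sqrt_le_sqrt hX3
    calc _ ≤ C₂ * (σ * M + σ * M) := h1.trans (by gcongr)
      _ ≤ C₂ * (4 * (σ * M)) := by gcongr; linarith
      _ ≤ _ := hfin

/-- Counting pairs whose axial range `M / |k|` is less than `|k|`. -/
theorem exists_card_gap_short_le : ∃ C : ℝ, 0 < C ∧ ∀ R : ℝ, 1 ≤ R →
    ∀ k : Mom, k ≠ 0 → ∀ M : ℝ, Real.sqrt R ≤ M → M < normSq k →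
    (((pairSet R k).filter fun p => (gap k p : ℝ) ≤ M).card : ℝ) ≤
      C * (Real.sqrt R * M + M ^ 2 / Real.sqrt (normSq k)) := by
  obtain ⟨C₁, hC₁, hann⟩ := Frame.exists_card_annulus_le
  obtain ⟨C₂, hC₂, hthin⟩ := Frame.exists_card_thin_annulus_le
  refine ⟨81 * C₁ + 4 * C₂, by positivity, fun R hR k hk M hM hKM => ?_⟩
  obtain ⟨F, hgap, hshift⟩ := Frame.exists_axis hk
  have hk1 := one_le_normSq hk
  have hK2 : Real.sqrt (normSq k) ^ 2 = normSq k := Real.sq_sqrt (by linarith)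
  have hK1 : 1 ≤ Real.sqrt (normSq k) := Real.one_le_sqrt.2 hk1
  have hR0 : 0 < R := by linarith
  have hfacts := fun (p : Mom) (hp : p ∈ (pairSet R k).filter fun p => (gap k p : ℝ) ≤ M) =>
    Frame.coord_bounds hR0.le (by linarith) hgap hshift (Finset.mem_filter.1 hp).1
      (Finset.mem_filter.1 hp).2
  rw [← hK2] at hKM
  set T := (pairSet R k).filter fun p => (gap k p : ℝ) ≤ M with hT
  set K := Real.sqrt (normSq k) with hKdef
  have hK0 : 0 < K := by linarith
  have hs1 : 1 ≤ Real.sqrt R := Real.one_le_sqrt.2 hR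
  have hs2 : Real.sqrt R ^ 2 = R := Real.sq_sqrt hR0.le
  set σ := Real.sqrt R with hσ
  have hM1 : 1 ≤ M := hs1.trans hM
  have hM0 : 0 < M := by linarith
  have hσ0 : 0 ≤ σ := by linarith
  have hRM : R ≤ σ * M := by
    calc R = σ * σ := by rw [← pow_two, hs2]
      _ ≤ σ * M := by gcongr
  have hMs : M ≤ σ * M := le_mul_of_one_le_left hM0.le hs1
  have hM2 : M ^ 2 / K = M / K * M := by ring
  rw [hM2]
  clear hM2
  set H := M / K with hH
  have hH0 : 0 < H := by positivity
  have hHK : H * K = M := div_mul_cancel₀ _ hK0.ne'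
  have hHM0 : 0 < H * M := by positivity
  have h4 : 0 ≤ σ * M := by positivity
  have hfin : C₂ * (4 * (σ * M)) ≤ (81 * C₁ + 4 * C₂) * (σ * M + H * M) := by
    rw [show (81 * C₁ + 4 * C₂) * (σ * M + H * M) =
      C₂ * (4 * (σ * M)) + (81 * C₁ * (σ * M) + (81 * C₁ + 4 * C₂) * (H * M)) by ring]
    exact le_add_of_nonneg_right (by positivity)
  have hHK' : H < K := by rw [hH, div_lt_iff₀ hK0, ← pow_two]; exact hKM
  have ht : ∀ p ∈ T, K / 2 ≤ F.t p ∧ F.t p ≤ K / 2 + (H + 1) := fun p hp =>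
    ⟨(hfacts p hp).1, by linarith [(hfacts p hp).2.1]⟩
  -- the projection lies in an annulus of area `((K + H) / 2)² - ((K - H) / 2)² = H K = M`
  have hq : ∀ p ∈ T, R ^ 2 - ((K + H) / 2) ^ 2 ≤ F.perpSq p ∧
      F.perpSq p ≤ R ^ 2 - ((K + H) / 2) ^ 2 + M := by
    intro p hp
    obtain ⟨h1, h2, h3, h4⟩ := hfacts p hp
    constructor
    · linarith [pow_le_pow_left₀ (by linarith : 0 ≤ F.t p)
        (by linarith : F.t p ≤ (K + H) / 2) 2]
    · have h5 := pow_le_pow_left₀ (by linarith : 0 ≤ (K - H) / 2)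
        (by linarith : (K - H) / 2 ≤ K - F.t p) 2
      linarith
  have h1 := hann F T (K / 2) (H + 1) (max 0 (R ^ 2 - ((K + H) / 2) ^ 2)) M (by linarith)
    (le_max_left _ _) hM0.le ht fun p hp => ⟨max_le (F.perpSq_nonneg p) (hq p hp).1,
      (hq p hp).2.trans (by linarith [le_max_right 0 (R ^ 2 - ((K + H) / 2) ^ 2)])⟩
  have h2 : Real.sqrt (max 0 (R ^ 2 - ((K + H) / 2) ^ 2)) ≤ R := by
    rw [Real.sqrt_le_left hR0.le]
    exact max_le (sq_nonneg _) (by linarith [sq_nonneg ((K + H) / 2)])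
  -- area and perimeter suffice if the annulus is wide, or if `k` is so long that the axial range
  -- is bounded; otherwise the annulus is thin and its radius is of order `R`
  rcases le_or_gt (R / 40) M with hMR | hMR
  · calc _ ≤ C₁ * (H + 1) * (M + Real.sqrt (max 0 (R ^ 2 - ((K + H) / 2) ^ 2)) + 1) := h1
      _ ≤ C₁ * (H + 1) * (81 * M) := by gcongr; linarith
      _ = 81 * C₁ * (M + H * M) := by ring
      _ ≤ _ := by
        have : 0 ≤ σ * M := by positivity
        gcongr
        linarith
  rcases le_or_gt (R / 2) K with hKR | hKR
  · have hH1 : H ≤ 1 := by rw [hH, div_le_one hK0]; linarith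
    calc _ ≤ C₁ * (H + 1) * (M + Real.sqrt (max 0 (R ^ 2 - ((K + H) / 2) ^ 2)) + 1) := h1
      _ ≤ C₁ * (1 + 1) * (R + R + R) := by gcongr; linarith
      _ = 6 * C₁ * R := by ring
      _ ≤ 81 * C₁ * (σ * M) := by gcongr; norm_num
      _ ≤ _ := by gcongr <;> linarith
  · have hX : R ^ 2 / 4 ≤ R ^ 2 - ((K + H) / 2) ^ 2 := by
      linarith [sq_nonneg R, pow_le_pow_left₀ (by linarith : 0 ≤ (K + H) / 2)
        (by linarith : (K + H) / 2 ≤ R / 2) 2]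
    have hX2 : R / 2 ≤ Real.sqrt (R ^ 2 - ((K + H) / 2) ^ 2) := by
      apply Real.le_sqrt_of_sq_le; linarith
    have hX3 : Real.sqrt (R ^ 2 - ((K + H) / 2) ^ 2) ≤ R := by
      rw [Real.sqrt_le_left hR0.le]; linarith [sq_nonneg ((K + H) / 2)]
    set L := Real.sqrt M with hL
    have hL1 : 1 ≤ L := Real.one_le_sqrt.2 hM1
    have hL0 : 0 < L := by linarith
    have hL2 : L ^ 2 = M := Real.sq_sqrt hM0.le
    have hLK : L < K := lt_of_pow_lt_pow_left₀ 2 hK0.le (by rw [hL2]; exact hKM)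
    have hHL : H ≤ L := by
      rw [hH, div_le_iff₀ hK0]
      calc M = L * L := by rw [← pow_two, hL2]
        _ ≤ L * K := by gcongr
    have h1 := hthin F T (K / 2) (H + 1) (R ^ 2 - ((K + H) / 2) ^ 2) L (by linarith)
      (by linarith [sq_nonneg R]) hL1 (by rw [hL2]; linarith) ht (by rw [hL2]; exact hq)
    have h2 : Real.sqrt (R ^ 2 - ((K + H) / 2) ^ 2) * (H + 1) / L ≤ 2 * (σ * M) := by
      rw [div_le_iff₀ hL0]
      calc _ ≤ R * (2 * L) := by gcongr; linarith
        _ ≤ (σ * M) * (2 * L) := by gcongr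
        _ = _ := by ring
    have h3 : Real.sqrt (Real.sqrt (R ^ 2 - ((K + H) / 2) ^ 2)) * L * (H + 1) ≤
        2 * (σ * M) := by
      calc _ ≤ σ * L * (2 * L) := by
            have := Real.sqrt_le_sqrt hX3
            gcongr
            linarith
        _ = _ := by rw [← hL2]; ring
    calc _ ≤ C₂ * (2 * (σ * M) + 2 * (σ * M)) := h1.trans (by gcongr)
      _ = C₂ * (4 * (σ * M)) := by ring
      _ ≤ _ := hfin

/-- The number of pairs with gap at most `M` is bounded by `M² / |k|`, the order of the volume of
the corresponding region, and an error `√R M`. -/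
theorem exists_card_gap_le : ∃ C : ℝ, 0 < C ∧ ∀ R : ℝ, 1 ≤ R → ∀ k : Mom, k ≠ 0 → ∀ M : ℝ,
    Real.sqrt R ≤ M → (((pairSet R k).filter fun p => (gap k p : ℝ) ≤ M).card : ℝ) ≤
      C * (Real.sqrt R * M + M ^ 2 / Real.sqrt (normSq k)) := by
  obtain ⟨C₁, hC₁, hlong⟩ := exists_card_gap_long_le
  obtain ⟨C₂, hC₂, hshort⟩ := exists_card_gap_short_le
  refine ⟨max C₁ C₂, lt_max_of_lt_left hC₁, fun R hR k hk M hM => ?_⟩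
  have hM0 : 0 ≤ M := (Real.sqrt_nonneg _).trans hM
  rcases le_or_gt (normSq k) M with h | h
  · refine (hlong R hR k hk M hM h).trans ?_
    gcongr
    exact le_max_left _ _
  · refine (hshort R hR k hk M hM h).trans ?_
    gcongr
    exact le_max_right _ _

/-! ### The lattice sum over inverse gaps -/

theorem two_mul_dotProduct_le (a k : Mom) {s : ℝ} (hs : 0 < s) :
    2 * ((a ⬝ᵥ k : ℤ) : ℝ) ≤ s * normSq a + normSq k / s := by
  have h : ∀ i, 2 * ((a i : ℝ) * k i) ≤ s * (a i : ℝ) ^ 2 + (k i : ℝ) ^ 2 / s := by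
    intro i
    have h1 : s * (a i : ℝ) ^ 2 + (k i : ℝ) ^ 2 / s - 2 * ((a i : ℝ) * k i) =
        (s * a i - k i) ^ 2 / s := by field_simp; ring
    have h2 : 0 ≤ (s * a i - k i) ^ 2 / s := by positivity
    linarith
  rw [dotProduct, normSq, normSq, Finset.mul_sum, Finset.sum_div, ← Finset.sum_add_distrib]
  push_cast
  rw [Finset.mul_sum]
  exact Finset.sum_le_sum fun i _ => h i

theorem gap_eq_sub (k p : Mom) : (gap k p : ℝ) = 2 * (((p - k) ⬝ᵥ k : ℤ) : ℝ) + normSq k := by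
  rw [gap_eq, sub_dotProduct, normSq_eq_dotProduct]
  push_cast; ring

/-- Gaps are at most `2|k|R + k²`. -/
theorem gap_le {R : ℝ} (hR : 0 < R) {k p : Mom} (hk : k ≠ 0) (hp : p ∈ pairSet R k) :
    (gap k p : ℝ) ≤ 2 * Real.sqrt (normSq k) * R + normSq k := by
  have hk1 := one_le_normSq hk
  have hK2 : Real.sqrt (normSq k) ^ 2 = normSq k := Real.sq_sqrt (by linarith)
  have hK0 : 0 < Real.sqrt (normSq k) := Real.sqrt_pos.2 (by linarith)
  set K := Real.sqrt (normSq k) with hK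
  have h1 := (mem_pairSet hR.le k p).1 hp
  have h2 := two_mul_dotProduct_le (p - k) k (div_pos hK0 hR)
  rw [gap_eq_sub]
  have h3 : K / R * normSq (p - k) ≤ K / R * R ^ 2 := by gcongr; exact h1.1
  have h4 : K / R * R ^ 2 = K * R := by field_simp
  have h5 : normSq k / (K / R) = K * R := by rw [← hK2]; field_simp
  linarith

/-- The number of dyadic shells up to `15 R²`, a bound for all gaps when `|k| ≤ 3R`. -/
theorem exists_dyadic_exponent_le {ε : ℝ} (hε : 0 < ε) : ∃ C : ℝ, 0 < C ∧ ∀ R : ℝ, 1 ≤ R → ∀ n : ℕ,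
    (2 : ℝ) ^ n ≤ 15 * R ^ 2 → (n : ℝ) + 1 ≤ C * R ^ ε := by
  have hlog : 0 < Real.log 2 := Real.log_pos one_lt_two
  refine ⟨15 ^ (ε / 2) / (ε / 2) / Real.log 2 + 1, by positivity, fun R hR n hn => ?_⟩
  have h1 : n * Real.log 2 ≤ (15 * R ^ 2) ^ (ε / 2) / (ε / 2) := by
    rw [← Real.log_pow]
    exact (Real.log_le_log (by positivity) hn).trans
      (Real.log_le_rpow_div (by positivity) (by positivity))
  have h2 : (15 * R ^ 2) ^ (ε / 2) = 15 ^ (ε / 2) * R ^ ε := by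
    rw [Real.mul_rpow (by norm_num) (by positivity), ← Real.rpow_natCast,
      ← Real.rpow_mul (by linarith)]
    congr 2
    push_cast; ring
  rw [h2, ← le_div_iff₀ hlog] at h1
  have h3 : 1 ≤ R ^ ε := Real.one_le_rpow hR hε.le
  calc (n : ℝ) + 1 ≤ 15 ^ (ε / 2) * R ^ ε / (ε / 2) / Real.log 2 + R ^ ε := by linarith
    _ = _ := by ring

/-- The lattice sum over inverse gaps: gaps up to `√R` are handled by the divisor bound, larger
ones by counting in dyadic shells. -/
theorem exists_sum_gap_le {ε : ℝ} (hε : 0 < ε) : ∃ C : ℝ, 0 < C ∧ ∀ R : ℝ, 1 ≤ R →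
    ∀ k : Mom, k ≠ 0 → normSq k ≤ 9 * R ^ 2 → ∀ M : ℝ, 0 < M →
    ∑ p ∈ pairSet R k with (gap k p : ℝ) ≤ M, (gap k p : ℝ)⁻¹ ≤
      C * (R ^ (1 / 2 + ε) + M / Real.sqrt (normSq k)) := by
  obtain ⟨C₁, hC₁, hsmall⟩ := exists_sum_gap_small_le hε
  obtain ⟨C₂, hC₂, hcount⟩ := exists_card_gap_le
  obtain ⟨C₃, hC₃, hdy⟩ := exists_dyadic_exponent_le hε
  refine ⟨C₁ + C₂ * (2 * C₃ + 8), by positivity, fun R hR k hk hkR M hM => ?_⟩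
  have hR0 : 0 < R := by linarith
  have hk1 := one_le_normSq hk
  have hK2 : Real.sqrt (normSq k) ^ 2 = normSq k := Real.sq_sqrt (by linarith)
  have hK0 : 0 < Real.sqrt (normSq k) := Real.sqrt_pos.2 (by linarith)
  have hK3 : Real.sqrt (normSq k) ≤ 3 * R := by
    rw [Real.sqrt_le_left (by positivity)]; linarith
  set K := Real.sqrt (normSq k) with hK
  have hinv : ∀ p ∈ pairSet R k, 0 ≤ (gap k p : ℝ)⁻¹ := fun p hp => by
    have : (1 : ℝ) ≤ gap k p := by exact_mod_cast one_le_gap hR0.le hp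
    positivity
  set T := (pairSet R k).filter fun p => (gap k p : ℝ) ≤ M ∧ Real.sqrt R < gap k p with hT
  have hsplit : ∑ p ∈ pairSet R k with (gap k p : ℝ) ≤ M, (gap k p : ℝ)⁻¹ ≤
      ∑ p ∈ pairSet R k with (gap k p : ℝ) ≤ Real.sqrt R, (gap k p : ℝ)⁻¹ +
        ∑ p ∈ T, (gap k p : ℝ)⁻¹ := by
    rw [← Finset.sum_union]
    · refine Finset.sum_le_sum_of_subset_of_nonneg (fun p hp => ?_) fun p hp _ => ?_
      · obtain ⟨h1, h2⟩ := Finset.mem_filter.1 hp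
        simp only [hT, Finset.mem_union, Finset.mem_filter, h1, h2, true_and]
        exact le_or_gt _ _
      · rcases Finset.mem_union.1 hp with h | h
        · exact hinv p (Finset.mem_filter.1 h).1
        · exact hinv p (Finset.mem_filter.1 h).1
    · rw [Finset.disjoint_left]
      intro p hp hp'
      exact absurd (Finset.mem_filter.1 hp).2 (not_le.2 (Finset.mem_filter.1 hp').2.2)
  -- the dyadic shell of a pair
  let j : Mom → ℕ := fun p => Nat.log 2 (gap k p).toNat
  have hj : ∀ p ∈ T, (2 : ℝ) ^ j p ≤ gap k p ∧ (gap k p : ℝ) < 2 ^ (j p + 1) := by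
    intro p hp
    have h1 := one_le_gap hR0.le (Finset.mem_filter.1 hp).1
    have h2 : ((gap k p).toNat : ℝ) = gap k p := by
      exact_mod_cast congrArg (Int.cast : ℤ → ℝ) (Int.toNat_of_nonneg (by omega : 0 ≤ gap k p))
    rw [← h2]
    constructor
    · exact_mod_cast Nat.pow_log_le_self 2 (by omega : (gap k p).toNat ≠ 0)
    · exact_mod_cast Nat.lt_pow_succ_log_self one_lt_two (gap k p).toNat
  have hlarge : ∑ p ∈ T, (gap k p : ℝ)⁻¹ ≤
      C₂ * (2 * C₃ + 8) * (R ^ (1 / 2 + ε) + M / K) := by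
    have hRε : 0 < R ^ (1 / 2 + ε) := by positivity
    have hMK : 0 < M / K := by positivity
    rcases T.eq_empty_or_nonempty with hTe | hTne
    · rw [hTe, Finset.sum_empty]; positivity
    obtain ⟨p₁, hp₁, hmax⟩ := T.exists_max_image j hTne
    set n := j p₁ with hn
    have hnM : (2 : ℝ) ^ n ≤ M := (hj p₁ hp₁).1.trans (Finset.mem_filter.1 hp₁).2.1
    have hnR : (2 : ℝ) ^ n ≤ 15 * R ^ 2 := by
      refine (hj p₁ hp₁).1.trans ((gap_le hR0 hk (Finset.mem_filter.1 hp₁).1).trans ?_)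
      nlinarith
    have hmaps : ∀ p ∈ T, j p ∈ Finset.range (n + 1) := fun p hp =>
      Finset.mem_range.2 (Nat.lt_succ_of_le (hmax p hp))
    rw [← Finset.sum_fiberwise_of_maps_to hmaps]
    have hshell : ∀ i ∈ Finset.range (n + 1), ∑ p ∈ T with j p = i, (gap k p : ℝ)⁻¹ ≤
        C₂ * (2 * Real.sqrt R + 4 / K * 2 ^ i) := by
      intro i _
      have hi0 : (0 : ℝ) < 2 ^ i := by positivity
      rcases Finset.eq_empty_or_nonempty (T.filter fun p => j p = i) with he | ⟨q, hq⟩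
      · rw [he, Finset.sum_empty]; positivity
      obtain ⟨hqT, hqi⟩ := Finset.mem_filter.1 hq
      have hiR : Real.sqrt R ≤ 2 ^ (i + 1) := by
        rw [← hqi]
        exact ((Finset.mem_filter.1 hqT).2.2.trans (hj q hqT).2).le
      have h1 := hcount R hR k hk (2 ^ (i + 1)) hiR
      have h2 : ((T.filter fun p => j p = i).card : ℝ) ≤
          C₂ * (Real.sqrt R * 2 ^ (i + 1) + (2 ^ (i + 1)) ^ 2 / K) := by
        refine le_trans (Nat.cast_le.2 (Finset.card_le_card fun p hp => ?_)) h1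
        obtain ⟨hpT, hpi⟩ := Finset.mem_filter.1 hp
        refine Finset.mem_filter.2 ⟨(Finset.mem_filter.1 hpT).1, ?_⟩
        rw [← hpi]
        exact (hj p hpT).2.le
      calc ∑ p ∈ T with j p = i, (gap k p : ℝ)⁻¹
          ≤ ∑ p ∈ T with j p = i, ((2 : ℝ) ^ i)⁻¹ := by
            refine Finset.sum_le_sum fun p hp => ?_
            obtain ⟨hpT, hpi⟩ := Finset.mem_filter.1 hp
            refine inv_anti₀ hi0 ?_
            rw [← hpi]
            exact (hj p hpT).1
        _ = ((T.filter fun p => j p = i).card : ℝ) * ((2 : ℝ) ^ i)⁻¹ := by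
            rw [Finset.sum_const, nsmul_eq_mul]
        _ ≤ C₂ * (Real.sqrt R * 2 ^ (i + 1) + (2 ^ (i + 1)) ^ 2 / K) * ((2 : ℝ) ^ i)⁻¹ := by
            gcongr
        _ = _ := by
            rw [pow_succ]
            field_simp
            ring
    refine (Finset.sum_le_sum hshell).trans ?_
    rw [← Finset.mul_sum, Finset.sum_add_distrib, Finset.sum_const, Finset.card_range,
      nsmul_eq_mul, ← Finset.mul_sum, geom_sum_eq (by norm_num), mul_assoc]
    refine mul_le_mul_of_nonneg_left ?_ hC₂.le
    have h3 := hdy R hR n hnR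
    have h4 : Real.sqrt R * R ^ ε = R ^ (1 / 2 + ε) := by
      rw [Real.rpow_add hR0, Real.sqrt_eq_rpow]
    have h5 : ((n + 1 : ℕ) : ℝ) * (2 * Real.sqrt R) ≤ 2 * C₃ * R ^ (1 / 2 + ε) := by
      push_cast
      calc ((n : ℝ) + 1) * (2 * Real.sqrt R) ≤ (C₃ * R ^ ε) * (2 * Real.sqrt R) := by gcongr
        _ = 2 * C₃ * (Real.sqrt R * R ^ ε) := by ring
        _ = _ := by rw [h4]
    have h6 : 4 / K * ((2 ^ (n + 1) - 1) / (2 - 1)) ≤ 8 * (M / K) := by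
      calc 4 / K * (((2 : ℝ) ^ (n + 1) - 1) / (2 - 1)) ≤ 4 / K * (2 * M) := by
            gcongr
            rw [pow_succ]; linarith
        _ = _ := by ring
    have h7 : 0 ≤ C₃ * (M / K) := by positivity
    nlinarith
  have hsm := hsmall R hR k hkR
  have hMK : 0 ≤ C₁ * (M / K) := by positivity
  linarith

/-! ### Number of particles -/

theorem one_le_numPart {kF : ℝ} (hkF : 0 ≤ kF) : 1 ≤ numPart kF := by
  have : (0 : Mom) ∈ fermiBall kF := by
    rw [mem_fermiBall hkF]
    simpa [normSq] using sq_nonneg kF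
  rw [numPart]
  exact_mod_cast Finset.card_pos.2 ⟨_, this⟩

theorem card_pairSet_le (kF : ℝ) (k : Mom) : ((pairSet kF k).card : ℝ) ≤ numPart kF := by
  rw [numPart]
  exact_mod_cast (Finset.card_le_card Finset.sdiff_subset).trans Finset.card_image_le

theorem numPart_of_lt_one {kF : ℝ} (hkF : 0 ≤ kF) (h : kF < 1) : numPart kF = 1 := by
  refine le_antisymm ?_ (one_le_numPart hkF)
  rw [numPart]
  have : (fermiBall kF).card ≤ 1 := by
    rw [Finset.card_le_one]
    have hz : ∀ p ∈ fermiBall kF, p = 0 := by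
      intro p hp
      by_contra hne
      have h1 := (mem_fermiBall hkF p).1 hp
      have h2 := one_le_normSq hne
      nlinarith
    intro p hp q hq
    rw [hz p hp, hz q hq]
  exact_mod_cast this

theorem le_numPart {R : ℝ} (hR : 1 ≤ R) : R ^ 3 ≤ 8 * numPart R := by
  have hfl := Int.floor_nonneg.2 (by linarith : 0 ≤ R / 2)
  have hsub : (Fintype.piFinset fun _ : Fin 3 => Finset.Icc (-⌊R / 2⌋) ⌊R / 2⌋) ⊆
      fermiBall R := by
    intro p hp
    rw [mem_fermiBall (by linarith)]
    have h1 : ∀ i, (p i : ℝ) ^ 2 ≤ (R / 2) ^ 2 := by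
      intro i
      obtain ⟨h2, h3⟩ := Finset.mem_Icc.1 (Fintype.mem_piFinset.1 hp i)
      have h4 : (p i : ℝ) ≤ R / 2 := Int.le_floor.1 h3
      have h5 : ((-p i : ℤ) : ℝ) ≤ R / 2 := Int.le_floor.1 (by omega)
      push_cast at h5
      exact sq_le_sq' (by linarith) h4
    calc normSq p ≤ ∑ _i : Fin 3, (R / 2) ^ 2 := Finset.sum_le_sum fun i _ => h1 i
      _ = 3 * (R / 2) ^ 2 := by simp
      _ ≤ _ := by nlinarith
  have hcard := Finset.card_le_card hsub
  rw [Fintype.card_piFinset] at hcard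
  simp only [Int.card_Icc, Finset.prod_const, Finset.card_univ, Fintype.card_fin] at hcard
  have h1 : (((⌊R / 2⌋ + 1 - -⌊R / 2⌋).toNat : ℕ) : ℝ) = 2 * ⌊R / 2⌋ + 1 := by
    have := congrArg (Int.cast : ℤ → ℝ)
      (Int.toNat_of_nonneg (by omega : 0 ≤ ⌊R / 2⌋ + 1 - -⌊R / 2⌋))
    push_cast at this
    rw [this]; ring
  have h2 : ((2 : ℝ) * ⌊R / 2⌋ + 1) ^ 3 ≤ numPart R := by
    rw [← h1, numPart]; exact_mod_cast hcard
  have h3 := Int.lt_floor_add_one (R / 2)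
  have h4 : (0 : ℝ) ≤ ⌊R / 2⌋ := by exact_mod_cast hfl
  have h5 : R / 2 ≤ 2 * ⌊R / 2⌋ + 1 := by linarith
  have h6 := pow_le_pow_left₀ (by linarith) h5 3
  nlinarith

theorem numPart_le {R : ℝ} (hR : 1 ≤ R) : numPart R ≤ 27 * R ^ 3 := by
  have hfl := Int.floor_nonneg.2 (by linarith : 0 ≤ R)
  have hsub : fermiBall R ⊆ (Fintype.piFinset fun _ : Fin 3 => Finset.Icc (-⌊R⌋) ⌊R⌋) := by
    intro p hp
    rw [mem_fermiBall (by linarith)] at hp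
    refine Fintype.mem_piFinset.2 fun i => ?_
    have h1 : (p i : ℝ) ^ 2 ≤ R ^ 2 := le_trans
      (Finset.single_le_sum (f := fun i => (p i : ℝ) ^ 2) (fun j _ => sq_nonneg _)
        (Finset.mem_univ i)) hp
    obtain ⟨h2, h3⟩ := abs_le_of_sq_le_sq' h1 (by linarith)
    have h4 : -p i ≤ ⌊R⌋ := Int.le_floor.2 (by push_cast; linarith)
    exact Finset.mem_Icc.2 ⟨by omega, Int.le_floor.2 h3⟩
  have hcard := Finset.card_le_card hsub
  rw [Fintype.card_piFinset] at hcard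
  simp only [Int.card_Icc, Finset.prod_const, Finset.card_univ, Fintype.card_fin] at hcard
  have h1 : (((⌊R⌋ + 1 - -⌊R⌋).toNat : ℕ) : ℝ) = 2 * ⌊R⌋ + 1 := by
    have := congrArg (Int.cast : ℤ → ℝ)
      (Int.toNat_of_nonneg (by omega : 0 ≤ ⌊R⌋ + 1 - -⌊R⌋))
    push_cast at this
    rw [this]; ring
  have h2 : numPart R ≤ ((2 : ℝ) * ⌊R⌋ + 1) ^ 3 := by
    rw [← h1, numPart]; exact_mod_cast hcard
  have h3 := Int.floor_le R
  have h4 : (0 : ℝ) ≤ ⌊R⌋ := by exact_mod_cast hfl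
  calc numPart R ≤ (2 * ⌊R⌋ + 1) ^ 3 := h2
    _ ≤ (3 * R) ^ 3 := by gcongr; linarith
    _ = _ := by ring

theorem le_numPart_rpow {R : ℝ} (hR : 1 ≤ R) : R ≤ 2 * numPart R ^ (1 / 3 : ℝ) := by
  have h1 := le_numPart hR
  have hN := one_le_numPart (by linarith : 0 ≤ R)
  have h2 : R = (R ^ 3) ^ (1 / 3 : ℝ) := by
    rw [← Real.rpow_natCast, ← Real.rpow_mul (by linarith)]; norm_num
  have h3 : (8 : ℝ) ^ (1 / 3 : ℝ) = 2 := by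
    rw [show (8 : ℝ) = 2 ^ (3 : ℝ) by norm_num, ← Real.rpow_mul (by norm_num)]; norm_num
  calc R = (R ^ 3) ^ (1 / 3 : ℝ) := h2
    _ ≤ (8 * numPart R) ^ (1 / 3 : ℝ) := by gcongr
    _ = _ := by rw [Real.mul_rpow (by norm_num) (by linarith), h3]

/-! ### From the lattice sum to the pair operators -/

theorem energy_add_energy {kF : ℝ} (hkF : 0 < kF) {k p : Mom} (hp : p ∈ pairSet kF k) :
    energy kF p + energy kF (p - k) = numPart kF ^ (-(2 / 3) : ℝ) * gap k p := by
  have hN := one_le_numPart hkF.le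
  obtain ⟨h1, h2⟩ := (mem_pairSet hkF.le k p).1 hp
  have hN0 : 0 < numPart kF ^ (-(2 / 3) : ℝ) := by positivity
  have hh : hbar kF ^ 2 = numPart kF ^ (-(2 / 3) : ℝ) := by
    rw [hbar, ← Real.rpow_natCast, ← Real.rpow_mul (by linarith)]; norm_num
  have hκ : kappa kF ^ 2 = numPart kF ^ (-(2 / 3) : ℝ) * kF ^ 2 := by
    rw [kappa, div_pow, ← Real.rpow_natCast (numPart kF ^ (1 / 3 : ℝ)),
      ← Real.rpow_mul (by linarith), Real.rpow_neg (by linarith)]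
    norm_num
    ring
  rw [energy, energy, hh, hκ, ← mul_sub, ← mul_sub, abs_of_nonneg, abs_of_nonpos, gap_cast]
  · ring
  · exact mul_nonpos_of_nonneg_of_nonpos hN0.le (by linarith)
  · exact mul_nonneg hN0.le (by linarith)

theorem sum_inv_gap_le_card {kF : ℝ} (k : Mom) {T : Finset Mom}
    (hT : T ⊆ pairSet kF k) {g : ℝ} (hg : 0 < g) (hgap : ∀ p ∈ T, g ≤ gap k p) :
    ∑ p ∈ T, (gap k p : ℝ)⁻¹ ≤ numPart kF / g := by
  calc ∑ p ∈ T, (gap k p : ℝ)⁻¹ ≤ ∑ _p ∈ T, g⁻¹ :=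
        Finset.sum_le_sum fun p hp => inv_anti₀ hg (hgap p hp)
    _ = T.card * g⁻¹ := by rw [Finset.sum_const, nsmul_eq_mul]
    _ ≤ numPart kF * g⁻¹ := by
        gcongr
        exact (Nat.cast_le.2 (Finset.card_le_card hT)).trans (card_pairSet_le kF k)
    _ = _ := (div_eq_mul_inv _ _).symm

/-- For `|k| > 3R` all pairs are far apart in energy. -/
theorem le_gap_of_large {R : ℝ} (hR : 0 ≤ R) {k p : Mom} (hk : 9 * R ^ 2 < normSq k)
    (hp : p ∈ pairSet R k) : 3 * R ^ 2 ≤ gap k p := by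
  obtain ⟨h1, -⟩ := (mem_pairSet hR k p).1 hp
  have h2 := two_mul_dotProduct_le p k (by norm_num : (0 : ℝ) < 3 / 2)
  have h3 : (gap k p : ℝ) = 2 * ((p ⬝ᵥ k : ℤ) : ℝ) - normSq k := by
    rw [gap_eq, normSq_eq_dotProduct]; push_cast; ring
  have h4 := gap_cast k p
  linarith

/-- The lattice sum over all pairs is at most of order `N^{1/3}`. -/
theorem exists_sum_inv_gap_le : ∃ C : ℝ, 0 < C ∧ ∀ kF : ℝ, 0 < kF → ∀ k : Mom,
    ∑ p ∈ pairSet kF k, (gap k p : ℝ)⁻¹ ≤ C * numPart kF ^ (1 / 3 : ℝ) := by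
  obtain ⟨C, hC, hsum⟩ := exists_sum_gap_le (ε := 1 / 2) (by norm_num)
  refine ⟨12 * C + 18, by positivity, fun kF hkF k => ?_⟩
  have hN := one_le_numPart hkF.le
  have hN3 : 1 ≤ numPart kF ^ (1 / 3 : ℝ) := Real.one_le_rpow hN (by norm_num)
  have hgap1 : ∀ p ∈ pairSet kF k, (1 : ℝ) ≤ gap k p := fun p hp => by
    exact_mod_cast one_le_gap hkF.le hp
  rcases eq_or_ne k 0 with rfl | hk
  · rw [pairSet_zero hkF.le, Finset.sum_empty]; positivity
  rcases lt_or_ge kF 1 with h1 | h1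
  · have h2 := sum_inv_gap_le_card k subset_rfl one_pos hgap1
    rw [numPart_of_lt_one hkF.le h1] at h2 ⊢
    rw [Real.one_rpow]
    linarith
  have hRN := le_numPart_rpow h1
  rcases le_or_gt (normSq k) (9 * kF ^ 2) with h2 | h2
  · have hk1 := one_le_normSq hk
    have hK2 : Real.sqrt (normSq k) ^ 2 = normSq k := Real.sq_sqrt (by linarith)
    have hK0 : 0 < Real.sqrt (normSq k) := Real.sqrt_pos.2 (by linarith)
    have hK3 : Real.sqrt (normSq k) ≤ 3 * kF := by
      rw [Real.sqrt_le_left (by positivity)]; linarith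
    have h3 := hsum kF h1 k hk h2 (5 * kF * Real.sqrt (normSq k)) (by positivity)
    rw [mul_div_cancel_right₀ _ hK0.ne', show (1 / 2 + 1 / 2 : ℝ) = 1 by norm_num,
      Real.rpow_one, Finset.filter_true_of_mem] at h3
    · nlinarith
    · intro p hp
      refine (gap_le hkF hk hp).trans ?_
      nlinarith
  · have h3 := sum_inv_gap_le_card k subset_rfl (by positivity : 0 < 3 * kF ^ 2)
      fun p hp => le_gap_of_large hkF.le h2 hp
    have h4 : numPart kF / (3 * kF ^ 2) ≤ 9 * kF := by
      rw [div_le_iff₀ (by positivity)]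
      linarith [numPart_le h1]
    nlinarith

/-- The lattice sum over the pairs with gap at most `c N^{1/3 - δ}`. -/
theorem exists_sum_inv_gap_restricted_le {δ c : ℝ} (hδ : 0 < δ) (hδ' : δ < 1 / 6) (hc : 0 < c) :
    ∃ C : ℝ, 0 < C ∧ ∀ kF : ℝ, 0 < kF → ∀ k : Mom,
      ∑ p ∈ pairSet kF k with (gap k p : ℝ) ≤ c * numPart kF ^ (1 / 3 - δ), (gap k p : ℝ)⁻¹ ≤
        C * numPart kF ^ (1 / 3 - δ) := by
  obtain ⟨C, hC, hsum⟩ := exists_sum_gap_le (ε := 1 / 2 - 3 * δ) (by linarith)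
  refine ⟨C * (2 + c) + 3 * c + 1, by positivity, fun kF hkF k => ?_⟩
  have hN := one_le_numPart hkF.le
  have hNδ : 1 ≤ numPart kF ^ (1 / 3 - δ) := Real.one_le_rpow hN (by linarith)
  have hgap1 : ∀ p ∈ pairSet kF k, (1 : ℝ) ≤ gap k p := fun p hp => by
    exact_mod_cast one_le_gap hkF.le hp
  rcases eq_or_ne k 0 with rfl | hk
  · rw [pairSet_zero hkF.le, Finset.filter_empty, Finset.sum_empty]; positivity
  set E := numPart kF ^ (1 / 3 - δ) with hE
  have hE0 : 0 < E := by linarith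
  rcases lt_or_ge kF 1 with h1 | h1
  · have h2 := sum_inv_gap_le_card k (Finset.filter_subset
      (fun p => (gap k p : ℝ) ≤ c * E) _) one_pos fun p hp => hgap1 p (Finset.mem_filter.1 hp).1
    rw [numPart_of_lt_one hkF.le h1, div_one] at h2
    have h3 : 0 ≤ (C * (2 + c) + 3 * c) * E := by positivity
    linarith
  have hRN := le_numPart_rpow h1
  rcases le_or_gt (normSq k) (9 * kF ^ 2) with h2 | h2
  · have hK1 : 1 ≤ Real.sqrt (normSq k) := Real.one_le_sqrt.2 (one_le_normSq hk)
    have h3 := hsum kF h1 k hk h2 (c * E) (by positivity)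
    have h4 : c * E / Real.sqrt (normSq k) ≤ c * E := div_le_self (by positivity) hK1
    have h5 : kF ^ (1 / 2 + (1 / 2 - 3 * δ)) ≤ 2 * E := by
      calc kF ^ (1 / 2 + (1 / 2 - 3 * δ)) ≤
            (2 * numPart kF ^ (1 / 3 : ℝ)) ^ (1 / 2 + (1 / 2 - 3 * δ)) :=
              Real.rpow_le_rpow hkF.le hRN (by linarith)
        _ = 2 ^ (1 / 2 + (1 / 2 - 3 * δ)) * E := by
              rw [Real.mul_rpow (by norm_num) (by positivity), ← Real.rpow_mul (by linarith), hE]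
              congr 2
              ring
        _ ≤ 2 ^ (1 : ℝ) * E := by
              gcongr
              · norm_num
              · linarith
        _ = 2 * E := by rw [Real.rpow_one]
    calc _ ≤ C * (kF ^ (1 / 2 + (1 / 2 - 3 * δ)) + c * E / Real.sqrt (normSq k)) := h3
      _ ≤ C * (2 * E + c * E) := by gcongr
      _ = C * (2 + c) * E := by ring
      _ ≤ _ := by
          have h6 : 0 ≤ (3 * c + 1) * E := by positivity
          linarith
  · set T := (pairSet kF k).filter fun p => (gap k p : ℝ) ≤ c * E with hT
    rcases T.eq_empty_or_nonempty with he | ⟨q, hq⟩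
    · rw [he, Finset.sum_empty]; positivity
    obtain ⟨hq1, hq2⟩ := Finset.mem_filter.1 hq
    have h3 := sum_inv_gap_le_card k (Finset.filter_subset
      (fun p => (gap k p : ℝ) ≤ c * E) _) (by positivity : 0 < 3 * kF ^ 2)
      fun p hp => le_gap_of_large hkF.le h2 (Finset.mem_filter.1 hp).1
    have h4 : numPart kF / (3 * kF ^ 2) ≤ 9 * kF := by
      rw [div_le_iff₀ (by positivity)]
      linarith [numPart_le h1]
    have h5 := le_gap_of_large hkF.le h2 hq1
    have h6 : kF ≤ kF ^ 2 := le_self_pow₀ h1 two_ne_zero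
    have h7 : 0 ≤ (C * (2 + c) + 1) * E := by positivity
    linarith

/-- An estimate of the inverse gaps over a set of pairs yields one of the pair operators. -/
theorem sum_norm_annih_annih_le_of_gap {kF : ℝ} (hkF : 0 < kF) (k : Mom) {T : Finset Mom}
    (hT : T ⊆ pairSet kF k) {C a : ℝ} (hC : 0 ≤ C)
    (h : ∑ p ∈ T, (gap k p : ℝ)⁻¹ ≤ C * numPart kF ^ a) (ψ : (kineticSqrt kF).domain) :
    ∑ p ∈ T, ‖annih p (annih (p - k) (ψ : Fock))‖ ≤
      Real.sqrt (2 * C) * numPart kF ^ (1 / 3 + a / 2) * ‖kineticSqrt kF ψ‖ := by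
  have hN := one_le_numPart hkF.le
  have hN0 : 0 < numPart kF := by linarith
  have hgap : ∀ p ∈ T, (0 : ℝ) < gap k p := fun p hp => by
    exact_mod_cast one_le_gap hkF.le (hT hp)
  have h1 : ∑ p ∈ T, (energy kF p + energy kF (p - k))⁻¹ ≤
      C * numPart kF ^ (2 / 3 + a) := by
    calc ∑ p ∈ T, (energy kF p + energy kF (p - k))⁻¹
        = numPart kF ^ (2 / 3 : ℝ) * ∑ p ∈ T, (gap k p : ℝ)⁻¹ := by
          rw [Finset.mul_sum]
          refine Finset.sum_congr rfl fun p hp => ?_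
          rw [energy_add_energy hkF (hT hp), mul_inv, Real.rpow_neg hN0.le, inv_inv]
      _ ≤ numPart kF ^ (2 / 3 : ℝ) * (C * numPart kF ^ a) := by gcongr
      _ = _ := by rw [Real.rpow_add hN0]; ring
  have h2 := sum_norm_annih_annih_le kF k T (fun p hp => by
    rw [energy_add_energy hkF (hT hp)]
    have := hgap p hp
    positivity) ψ h1
  have h3 : Real.sqrt (numPart kF ^ (2 / 3 + a)) = numPart kF ^ (1 / 3 + a / 2) := by
    rw [Real.sqrt_eq_rpow, ← Real.rpow_mul hN0.le]
    congr 1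
    ring
  rwa [← mul_assoc, Real.sqrt_mul (by positivity), h3] at h2

end FermiGas
end

open FermiGas
theorem lemma4p3 :
    (∃ C : ℝ, 0 < C ∧ ∀ kF : ℝ, 0 < kF → ∀ (k : Mom) (ψ : (kineticSqrt kF).domain),
      ∑ p ∈ pairSet kF k, ‖annih p (annih (p - k) (ψ : Fock))‖ ≤
        C * numPart kF ^ (1 / 2 : ℝ) * ‖kineticSqrt kF ψ‖) ∧
    (∀ δ : ℝ, 0 < δ → δ < 1 / 6 → ∀ c : ℝ, 0 < c → ∃ C : ℝ, 0 < C ∧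
      ∀ kF : ℝ, 0 < kF → ∀ (k : Mom) (ψ : (kineticSqrt kF).domain),
        ∑ p ∈ pairSet kF k with
            energy kF p + energy kF (p - k) ≤ c * numPart kF ^ (-(1 / 3) - δ),
          ‖annih p (annih (p - k) (ψ : Fock))‖ ≤
            C * numPart kF ^ (1 / 2 - δ / 2) * ‖kineticSqrt kF ψ‖) := by
  refine ⟨?_, fun δ hδ hδ' c hc => ?_⟩
  · obtain ⟨C, hC, h⟩ := exists_sum_inv_gap_le
    refine ⟨Real.sqrt (2 * C), by positivity, fun kF hkF k ψ => ?_⟩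
    have h1 := sum_norm_annih_annih_le_of_gap hkF k subset_rfl hC.le (h kF hkF k) ψ
    rwa [show (1 / 3 + 1 / 3 / 2 : ℝ) = 1 / 2 by norm_num] at h1
  · obtain ⟨C, hC, h⟩ := exists_sum_inv_gap_restricted_le hδ hδ' hc
    refine ⟨Real.sqrt (2 * C), by positivity, fun kF hkF k ψ => ?_⟩
    have hN : 0 < numPart kF := by linarith [one_le_numPart hkF.le]
    have hset : (pairSet kF k).filter (fun p =>
        energy kF p + energy kF (p - k) ≤ c * numPart kF ^ (-(1 / 3) - δ)) =
        (pairSet kF k).filter fun p => (gap k p : ℝ) ≤ c * numPart kF ^ (1 / 3 - δ) := by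
      refine Finset.filter_congr fun p hp => ?_
      rw [energy_add_energy hkF hp, show (-(1 / 3) - δ : ℝ) = -(2 / 3) + (1 / 3 - δ) by ring,
        Real.rpow_add hN, mul_left_comm c, mul_le_mul_iff_right₀ (by positivity)]
    rw [hset]
    have h1 := sum_norm_annih_annih_le_of_gap hkF k (Finset.filter_subset _ _) hC.le
      (h kF hkF k) ψ
    rwa [show (1 / 3 + (1 / 3 - δ) / 2 : ℝ) = 1 / 2 - δ / 2 by ring] at h1
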